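/- For an algebraic integer $\alpha$ let $M(\alpha)=\prod_{i}\max(1,|\alpha_i|)$ be its Mahler measure, where the $\alpha_i$ are the complex roots of its minimal polynomial over $\mathbb{Q}$. For a number field $K$ with discriminant $D_K$ and ring of integers $\mathcal{O}_K$ let \[ M(\mathcal{O}_K)=\min\{M(\alpha) : \alpha\in\mathcal{O}_K,\ \mathbb{Q}(\alpha)=K,\ M(\alpha)\neq 1\}. \] (a) There are, up to isomorphism, infinitely many cyclic (equivalently, Galois) cubic fields $K$, infinitely many totally real non-Galois cubic fields $K$, and infinitely many cubic fields $K$ that are not totally real, such that \[ M(\mathcal{O}_K)\le 2^{1/2}\,|D_K|^{1/4}. \] (b) Consequently the exponent $1/4$ in Silverman's lower bound $3^{-3/4}|D_K|^{1/4}\le M(\mathcal{O}_K)$ for cubic fields cannot be increased for any of the three types: for every $c>0$ and every $e>1/4$ there is a field $K$ of the given type with $M(\mathcal{O}_K)<c\,|D_K|^{e}$. (c) More precisely, up to isomorphism, there are infinitely many cyclic cubic fields $K$ with $M(\mathcal{O}_K)<2^{1/2}|D_K|^{1/4}$ among the splitting fields of $x^3+nx^2-(n+3)x+1$; infinitely many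 totally real non-Galois cubic fields $K$ with $M(\mathcal{O}_K)<|D_K|^{1/4}$ among the fields $\mathbb{Q}(\alpha)$ with $\alpha$ a root of $x^3-nx^2+n$; and infinitely many cubic fields $K$ that are not totally real, with $M(\mathcal{O}_K)<2^{-1/2}|D_K|^{1/4}$, among the fields $\mathbb{Q}(\alpha)$ with $\alpha$ a root of $x^3+nx^2+n$. Here $n$ ranges over the natural numbers. -/

import Mathlib

open Polynomial Module

namespace CubicMahler

noncomputable section

/-- The Mahler measure of an algebraic integer `α`: the Mahler measure of its minimal polynomial
over `ℤ` (monic, hence of content one), viewed in `ℂ[X]`. -/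
def mahler {K : Type*} [Field K] (α : NumberField.RingOfIntegers K) : ℝ :=
  ((minpoly ℤ (α : K)).map (Int.castRingHom ℂ)).mahlerMeasure

/-- The Mahler measures, other than `1`, of the integral generators of `K` over `ℚ`. -/
def integralMahlerValues (K : Type*) [Field K] [CharZero K] : Set ℝ :=
  {m | ∃ α : NumberField.RingOfIntegers K,
    IntermediateField.adjoin ℚ {(α : K)} = ⊤ ∧ mahler α ≠ 1 ∧ mahler α = m}

/-- `M(𝓞 K) = m`: the minimum over the non-torsion integral generators is attained, with
value `m`. -/
def HasMinIntegralMahler (K : Type*) [Field K] [CharZero K] (m : ℝ) : Prop :=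
  IsLeast (integralMahlerValues K) m

/-- The absolute value of the discriminant of `K`, as a real number. -/
def absDiscr (K : Type*) [Field K] [NumberField K] : ℝ :=
  |(NumberField.discr K : ℝ)|

/-- Galois cubic fields, that is, cubic fields which are cyclic over `ℚ`. -/
def IsCyclicCubic (K : Type*) [Field K] [NumberField K] : Prop :=
  finrank ℚ K = 3 ∧ IsGalois ℚ K ∧ IsCyclic (K ≃ₐ[ℚ] K)

def IsTotallyRealNonGaloisCubic (K : Type*) [Field K] [NumberField K] : Prop :=
  finrank ℚ K = 3 ∧ NumberField.IsTotallyReal K ∧ ¬ IsGalois ℚ K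

def IsNonTotallyRealCubic (K : Type*) [Field K] [NumberField K] : Prop :=
  finrank ℚ K = 3 ∧ ¬ NumberField.IsTotallyReal K

/-- Infinitely many number fields, up to isomorphism, satisfy `P`. Every number field is isomorphic
to a subfield of `ℂ`, so the fields are taken there. -/
def InfinitelyManyFields (P : (K : IntermediateField ℚ ℂ) → [NumberField K] → Prop) : Prop :=
  ∃ F : ℕ → IntermediateField ℚ ℂ,
    (∀ i, ∃ _ : NumberField (F i), P (F i)) ∧
    Pairwise fun i j => IsEmpty (F i ≃+* F j)

/-- No lower bound `c * |D_K| ^ e ≤ M(𝓞 K)` with `c > 0` and `e > 1/4` holds for all number fields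
`K` with the property `T`. -/
def ExponentQuarterIsSharp (T : (K : IntermediateField ℚ ℂ) → [NumberField K] → Prop) : Prop :=
  ∀ c e : ℝ, 0 < c → 1 / 4 < e →
    ∃ (K : IntermediateField ℚ ℂ) (_ : NumberField K), T K ∧
      ∃ m, HasMinIntegralMahler K m ∧ m < c * absDiscr K ^ e

/-- The simplest cubic polynomial `x³ + n x² - (n + 3) x + 1`. -/
def simplestCubic (n : ℕ) : ℚ[X] :=
  X ^ 3 + C (n : ℚ) * X ^ 2 - C ((n : ℚ) + 3) * X + 1

/-- The polynomial `x³ - n x² + n`. -/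
def realCubic (n : ℕ) : ℚ[X] :=
  X ^ 3 - C (n : ℚ) * X ^ 2 + C (n : ℚ)

/-- The polynomial `x³ + n x² + n`. -/
def complexCubic (n : ℕ) : ℚ[X] :=
  X ^ 3 + C (n : ℚ) * X ^ 2 + C (n : ℚ)

/-- `K` is the splitting field of `f` in `ℂ`. -/
def IsSplittingFieldIn (f : ℚ[X]) (K : IntermediateField ℚ ℂ) : Prop :=
  K = IntermediateField.adjoin ℚ (f.rootSet ℂ)

/-- `K` is generated over `ℚ` by one root of `f` in `ℂ`. -/
def IsRootField (f : ℚ[X]) (K : IntermediateField ℚ ℂ) : Prop :=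
  ∃ α ∈ f.rootSet ℂ, K = IntermediateField.adjoin ℚ {α}

end

end CubicMahler

open CubicMahler

/-! A root of each of the three cubics has Mahler measure of size about `n`, while the discriminants
of the cubics, `(n² + 3n + 9)²`, `n² (4n² - 27)` and `-n² (4n² + 27)`, have size about `n⁴`. So the
fourth-root bound holds, with the stated constants, as soon as the field discriminant equals the
polynomial discriminant, that is, as soon as `ℤ[α]` is the full ring of integers.

This is arranged by taking `n = 12 t + 1` and sieving over `t`. The congruence disposes of the
primes 2 and 3. `exists_forall_prime_sq_not_dvd` keeps squares of larger primes from dividing `n`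
and `(2n)² ± 27`, or `(2n + 3)² + 27 = 4 (n² + 3n + 9)`. A prime can then divide the polynomial
discriminant twice only where the cubic, or that of `3α + n`, is Eisenstein, and there `ℤ[α]` is
maximal. By `numberField_discr_eq_cubic_discr` the two discriminants agree.

Northcott's theorem (`exists_hasMinIntegralMahler_le`) supplies the minimum and bounds it by the
measure of the root. As `t` is arbitrarily large, the discriminants are unbounded, which yields
infinitely many fields up to isomorphism and the sharpness of the exponent. -/

/-! ### Sieving for values free of large prime squares -/

open Filter in
/-- The primes have density zero. -/
lemma eventually_primeCounting_le_mul {ε : ℝ} (hε : 0 < ε) :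
    ∀ᶠ n : ℕ in atTop, (Nat.primeCounting n : ℝ) ≤ ε * n := by
  have h1 := (tendsto_natCast_atTop_atTop (R := ℝ)).eventually
    (Chebyshev.eventually_primeCounting_le one_pos)
  have h2 := (Real.tendsto_log_atTop.comp
    (tendsto_natCast_atTop_atTop (R := ℝ))).eventually_ge_atTop ((Real.log 4 + 1) / ε)
  have h3 := (Real.tendsto_log_atTop.comp
    (tendsto_natCast_atTop_atTop (R := ℝ))).eventually_gt_atTop 0
  filter_upwards [h1, h2, h3] with n h1 h2 h3
  simp only [Function.comp_apply, Nat.floor_natCast] at h1 h2 h3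
  refine h1.trans ?_
  rw [div_le_iff₀ h3]
  rw [div_le_iff₀ hε] at h2
  nlinarith [mul_le_mul_of_nonneg_right h2 (Nat.cast_nonneg (α := ℝ) n)]

/-- A set of natural numbers meeting at most `k` residue classes modulo `m` has at most
`k * (X / m + 1)` elements below `X`. -/
lemma card_filter_range_le_of_mod_mem {S : ℕ → Prop} [DecidablePred S] {m : ℕ} (R : Finset ℕ)
    (hR : ∀ t, S t → t % m ∈ R) (X : ℕ) :
    ((Finset.range X).filter S).card ≤ R.card * (X / m + 1) := by
  rw [← Finset.card_range (X / m + 1), ← Finset.card_product]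
  refine Finset.card_le_card_of_injOn (fun t => (t % m, t / m)) ?_ ?_
  · intro t ht
    simp only [Finset.coe_filter, Finset.mem_range, Set.mem_ofPred_eq] at ht
    simp only [Finset.coe_product, Set.mem_prod, Finset.mem_coe, Finset.mem_range]
    exact ⟨hR t ht.2, Nat.lt_succ_of_le (Nat.div_le_div_right ht.1.le)⟩
  · intro s _ t _ h
    simp only [Prod.mk.injEq] at h
    rw [← Nat.mod_add_div s m, h.1, h.2, Nat.mod_add_div]

/-- The difference of the two values is `(u - v) (u + v)`. If `p` divided both factors it would
divide `2u`, hence `u`, hence `c`; so one factor takes all of `p²`. -/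
lemma sq_dvd_sub_or_add {p : ℕ} (hp : p.Prime) {c u v : ℤ} (h2 : ¬ (p : ℤ) ∣ 2)
    (hc : ¬ (p : ℤ) ∣ c) (hu : (p : ℤ) ^ 2 ∣ u ^ 2 + c) (hv : (p : ℤ) ^ 2 ∣ v ^ 2 + c) :
    (p : ℤ) ^ 2 ∣ u - v ∨ (p : ℤ) ^ 2 ∣ u + v := by
  have hp' : Prime (p : ℤ) := Nat.prime_iff_prime_int.mp hp
  have hmul : (p : ℤ) ^ 2 ∣ (u - v) * (u + v) := by
    have h := dvd_sub hu hv
    rwa [show u ^ 2 + c - (v ^ 2 + c) = (u - v) * (u + v) by ring] at h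
  by_cases h : (p : ℤ) ∣ u + v
  · right
    refine ((hp'.coprime_iff_not_dvd.mpr fun h' => ?_).pow_left).dvd_of_dvd_mul_left hmul
    have h3 : (p : ℤ) ∣ 2 * u := by
      have h3 := dvd_add h h'
      rwa [show u + v + (u - v) = 2 * u by ring] at h3
    have h4 : (p : ℤ) ∣ u ^ 2 + c := (dvd_pow_self _ two_ne_zero).trans hu
    exact hc ((dvd_add_right (dvd_pow ((hp'.dvd_or_dvd h3).resolve_left h2) two_ne_zero)).mp h4)
  · left
    exact ((hp'.coprime_iff_not_dvd.mpr h).pow_left).dvd_of_dvd_mul_right hmul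

/-- For a prime `p` not dividing `2 * a * c`, the congruence `(a t + b)² + c ≡ 0` has at most two
solutions modulo `p²`. -/
lemma card_filter_sq_dvd_sq_add_le {p : ℕ} (hp : p.Prime) {a b c : ℤ} (h2 : ¬ (p : ℤ) ∣ 2)
    (ha : ¬ (p : ℤ) ∣ a) (hc : ¬ (p : ℤ) ∣ c) (X : ℕ) :
    ((Finset.range X).filter fun t : ℕ => (p : ℤ) ^ 2 ∣ (a * t + b) ^ 2 + c).card ≤
      2 * (X / p ^ 2 + 1) := by
  classical
  have hp' : Prime (p : ℤ) := Nat.prime_iff_prime_int.mp hp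
  let R : Finset ℕ := (Finset.range (p ^ 2)).filter
    fun r => ∃ t : ℕ, (p : ℤ) ^ 2 ∣ (a * t + b) ^ 2 + c ∧ t % p ^ 2 = r
  have hR : R.card ≤ 2 := by
    by_contra! hlt
    obtain ⟨x, y, z, hx, hy, hz, hxy, hxz, hyz⟩ := Finset.two_lt_card_iff.mp hlt
    obtain ⟨s, hs, rfl⟩ := (Finset.mem_filter.mp hx).2
    obtain ⟨t, ht, rfl⟩ := (Finset.mem_filter.mp hy).2
    obtain ⟨u, hu, rfl⟩ := (Finset.mem_filter.mp hz).2
    have key : ∀ v w : ℕ, v % p ^ 2 ≠ w % p ^ 2 → ¬ (p : ℤ) ^ 2 ∣ (a * v + b) - (a * w + b) := by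
      intro v w hvw hd
      rw [show (a * v + b) - (a * w + b) = a * ((v : ℤ) - w) by ring] at hd
      have hd' := ((hp'.coprime_iff_not_dvd.mpr ha).pow_left).dvd_of_dvd_mul_left hd
      apply hvw
      have := (Int.modEq_iff_dvd.mpr hd').symm
      have h3 : (v : ℤ) ≡ w [ZMOD ((p ^ 2 : ℕ) : ℤ)] := by exact_mod_cast this
      exact Int.natCast_modEq_iff.mp h3
    -- Of three solutions in distinct classes, the second and third would both be opposite to the
    -- first, hence congruent to each other.
    have h1 := (sq_dvd_sub_or_add hp h2 hc hs ht).resolve_left (key s t hxy)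
    have h3 := (sq_dvd_sub_or_add hp h2 hc hs hu).resolve_left (key s u hxz)
    apply key t u hyz
    have h4 := dvd_sub h1 h3
    rwa [show a * (s : ℤ) + b + (a * t + b) - (a * s + b + (a * u + b)) =
      (a * t + b) - (a * u + b) by ring] at h4
  refine (card_filter_range_le_of_mod_mem R (fun t ht => ?_) X).trans
    (Nat.mul_le_mul_right _ hR)
  exact Finset.mem_filter.mpr
    ⟨Finset.mem_range.mpr (Nat.mod_lt _ (pow_pos hp.pos 2)), t, ht, rfl⟩

lemma card_filter_sq_dvd_linear_le {p : ℕ} (hp : p.Prime) {a b : ℕ} (ha : ¬ p ∣ a) (X : ℕ) :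
    ((Finset.range X).filter fun t : ℕ => p ^ 2 ∣ a * t + b).card ≤ X / p ^ 2 + 1 := by
  classical
  let R : Finset ℕ := (Finset.range (p ^ 2)).filter
    fun r => ∃ t : ℕ, p ^ 2 ∣ a * t + b ∧ t % p ^ 2 = r
  have hR : R.card ≤ 1 := by
    rw [Finset.card_le_one]
    intro x hx y hy
    obtain ⟨s, hs, rfl⟩ := (Finset.mem_filter.mp hx).2
    obtain ⟨t, ht, rfl⟩ := (Finset.mem_filter.mp hy).2
    have h1 : a * s + b ≡ a * t + b [MOD p ^ 2] :=
      ((Nat.modEq_zero_iff_dvd.mpr hs).trans (Nat.modEq_zero_iff_dvd.mpr ht).symm)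
    exact Nat.ModEq.cancel_left_of_coprime
      (((Nat.Prime.coprime_iff_not_dvd hp).mpr ha).pow_left 2) (Nat.ModEq.add_right_cancel' b h1)
  refine (card_filter_range_le_of_mod_mem R (fun t ht => ?_) X).trans
    ((Nat.mul_le_mul_right _ hR).trans (one_mul _).le)
  exact Finset.mem_filter.mpr
    ⟨Finset.mem_range.mpr (Nat.mod_lt _ (pow_pos hp.pos 2)), t, ht, rfl⟩

/-- Comparison with the telescoping bound for all integers above 4. The sieve removes at most three
classes modulo each `p²`, so starting at 5 leaves density at least `1 - 3/4`. -/
lemma sum_inv_sq_primes_le (s : Finset ℕ) (hs : ∀ p ∈ s, 5 ≤ p) :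
    ∑ p ∈ s, ((p : ℝ) ^ 2)⁻¹ ≤ 1 / 4 := by
  set n := s.sup id + 4
  have hsub : s ⊆ Finset.Ioc 4 n := fun p hp => by
    have : p ≤ s.sup id := Finset.le_sup (f := id) hp
    have := hs p hp
    simp only [Finset.mem_Ioc]; omega
  refine (Finset.sum_le_sum_of_subset_of_nonneg hsub fun _ _ _ => by positivity).trans ?_
  refine (sum_Ioc_inv_sq_le_sub (α := ℝ) (k := 4) (n := n) (by norm_num) (by omega)).trans ?_
  norm_num

/-- There are arbitrarily large `t` for which neither `12 t + 1` nor `(24 t + b)² ± 27` is divisible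
by the square of a prime `p ≥ 5`. -/
lemma exists_forall_prime_sq_not_dvd (b : ℕ) {c : ℤ} (hc : c = 27 ∨ c = -27) (B : ℕ) :
    ∃ t ≥ B, ∀ p : ℕ, p.Prime → 5 ≤ p →
      ¬ p ^ 2 ∣ 12 * t + 1 ∧ ¬ (p : ℤ) ^ 2 ∣ (24 * t + b) ^ 2 + c := by
  classical
  by_contra! hbad
  -- Budget: the main terms remove at most `3X/4`, the error terms at most `3 π(Y) ≤ 3 · 25X / 600 =
  -- X/8`, and `B + 1 ≤ X/16`. These add up to less than `X`.
  obtain ⟨N, hN⟩ := Filter.eventually_atTop.mp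
    (eventually_primeCounting_le_mul (ε := 1 / 600) (by norm_num))
  set X : ℕ := N + b + 6 + 16 * B + 16 with hX
  -- All sieved values are at most `Y²`, so only primes up to `Y` matter.
  set Y : ℕ := 24 * X + b + 6 with hY
  let s : Finset ℕ := (Nat.primesLE Y).filter (5 ≤ ·)
  let T : ℕ → Finset ℕ := fun p =>
    ((Finset.range X).filter fun t : ℕ => p ^ 2 ∣ 12 * t + 1) ∪
    ((Finset.range X).filter fun t : ℕ => (p : ℤ) ^ 2 ∣ (24 * t + b) ^ 2 + c)
  have hsp : ∀ p ∈ s, p.Prime ∧ 5 ≤ p := fun p hp => by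
    have := Finset.mem_filter.mp hp
    exact ⟨(Nat.mem_primesLE.mp this.1).2, this.2⟩
  -- Starting at `B + 1` gives `t ≥ 1`, which keeps `(24 t + b)² - 27` positive.
  have hcover : Finset.Ico (B + 1) X ⊆ s.biUnion T := by
    intro t ht
    rw [Finset.mem_Ico] at ht
    obtain ⟨p, hp, hp5, h⟩ := hbad t (by omega)
    have hmem : t ∈ T p := by
      by_cases h1 : p ^ 2 ∣ 12 * t + 1
      · exact Finset.mem_union_left _ (Finset.mem_filter.mpr ⟨Finset.mem_range.mpr ht.2, h1⟩)
      · exact Finset.mem_union_right _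
          (Finset.mem_filter.mpr ⟨Finset.mem_range.mpr ht.2, h h1⟩)
    refine Finset.mem_biUnion.mpr ⟨p, Finset.mem_filter.mpr
      ⟨Nat.mem_primesLE.mpr ⟨?_, hp⟩, hp5⟩, hmem⟩
    have ht1 : (1 : ℤ) ≤ t := by exact_mod_cast (by omega : 1 ≤ t)
    have htX : (t : ℤ) ≤ X := by exact_mod_cast ht.2.le
    have hb : (0 : ℤ) ≤ b := Int.natCast_nonneg b
    have hYZ : (Y : ℤ) = 24 * X + b + 6 := by rw [hY]; push_cast; ring
    refine Nat.pow_le_pow_iff_left (two_ne_zero) |>.mp ?_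
    rcases Finset.mem_union.mp hmem with h1 | h1
    · refine (Nat.le_of_dvd (by omega) (Finset.mem_filter.mp h1).2).trans ?_
      nlinarith [ht.2]
    · have h2 := Int.le_of_dvd (by rcases hc with rfl | rfl <;> nlinarith)
        (Finset.mem_filter.mp h1).2
      have h3 : (24 * (t : ℤ) + b) ^ 2 + c ≤ (Y : ℤ) ^ 2 := by
        rw [hYZ]
        have : (24 * (t : ℤ) + b) ^ 2 ≤ (24 * X + b) ^ 2 := by gcongr
        rcases hc with rfl | rfl <;> nlinarith
      exact_mod_cast h2.trans h3
  have hT : ∀ p ∈ s, ((T p).card : ℝ) ≤ 3 * X * ((p : ℝ) ^ 2)⁻¹ + 3 := by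
    intro p hp
    obtain ⟨hpp, hp5⟩ := hsp p hp
    have hsmall : ∀ q : ℕ, q.Prime → q < 5 → ¬ p ∣ q := fun q hq hq5 h => by
      have := (Nat.prime_dvd_prime_iff_eq hpp hq).mp h
      omega
    have hp2 := hsmall 2 Nat.prime_two (by norm_num)
    have hp3 := hsmall 3 Nat.prime_three (by norm_num)
    have h12 : ¬ p ∣ 12 := fun h => by
      rw [show 12 = 2 ^ 2 * 3 by norm_num] at h
      rcases (Nat.Prime.dvd_mul hpp).mp h with h | h
      exacts [hp2 (hpp.dvd_of_dvd_pow h), hp3 h]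
    have h24 : ¬ (p : ℤ) ∣ 24 := fun h => by
      have h : p ∣ 2 ^ 3 * 3 := by exact_mod_cast h
      rcases (Nat.Prime.dvd_mul hpp).mp h with h | h
      exacts [hp2 (hpp.dvd_of_dvd_pow h), hp3 h]
    have h27 : ¬ (p : ℤ) ∣ c := fun h => by
      have h : (p : ℤ) ∣ 27 := by rcases hc with rfl | rfl; exacts [h, (dvd_neg.mp h)]
      have h : p ∣ 3 ^ 3 := by exact_mod_cast h
      exact hp3 (hpp.dvd_of_dvd_pow h)
    have h1 := card_filter_sq_dvd_linear_le hpp (b := 1) h12 X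
    have h2 := card_filter_sq_dvd_sq_add_le hpp (a := 24) (b := b) (by exact_mod_cast hp2) h24 h27 X
    have h3 : (T p).card ≤ 3 * (X / p ^ 2 + 1) := (Finset.card_union_le _ _).trans (by omega)
    have h4 : ((X / p ^ 2 : ℕ) : ℝ) ≤ X * ((p : ℝ) ^ 2)⁻¹ := by
      refine Nat.cast_div_le.trans ?_
      rw [div_eq_mul_inv]; push_cast; rfl
    have h5 : ((T p).card : ℝ) ≤ 3 * ((X / p ^ 2 : ℕ) + 1) := by exact_mod_cast h3
    linarith
  have hcard : ((X - (B + 1) : ℕ) : ℝ) ≤ ∑ p ∈ s, ((T p).card : ℝ) := by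
    have := (Finset.card_le_card hcover).trans Finset.card_biUnion_le
    rw [Nat.card_Ico] at this
    exact_mod_cast this
  have hsum : ∑ p ∈ s, ((T p).card : ℝ) ≤ 3 * X * (1 / 4) + 3 * s.card := by
    refine (Finset.sum_le_sum hT).trans ?_
    rw [Finset.sum_add_distrib, ← Finset.mul_sum, Finset.sum_const, nsmul_eq_mul,
      mul_comm (s.card : ℝ)]
    gcongr
    exact sum_inv_sq_primes_le s fun p hp => (hsp p hp).2
  have hs : (s.card : ℝ) ≤ 1 / 600 * Y := by
    refine le_trans ?_ (hN Y (by omega))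
    rw [← Nat.primesLE_card_eq_primeCounting]
    exact_mod_cast Finset.card_filter_le _ _
  have hXB : ((X - (B + 1) : ℕ) : ℝ) = X - (B + 1) := by
    rw [Nat.cast_sub (by omega)]; push_cast; ring
  have hYX : (Y : ℝ) ≤ 25 * X := by exact_mod_cast (by omega : Y ≤ 25 * X)
  have hBX : (16 * B + 16 : ℝ) ≤ X := by exact_mod_cast (by omega : 16 * B + 16 ≤ X)
  rw [hXB] at hcard
  linarith

/-! ### Existence of the minimum, and consequences of unbounded discriminants -/

/-- By Northcott's theorem the minimum defining `M(𝓞 K)` exists, and it is bounded by the Mahler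
measure of any integral generator that is not a root of unity. -/
lemma exists_hasMinIntegralMahler_le {K : Type*} [Field K] [NumberField K]
    (α : NumberField.RingOfIntegers K) (hα : IntermediateField.adjoin ℚ {(α : K)} = ⊤)
    (h1 : mahler α ≠ 1) : ∃ m, HasMinIntegralMahler K m ∧ m ≤ mahler α := by
  set S := integralMahlerValues K ∩ Set.Iic (mahler α)
  have hdeg (β : NumberField.RingOfIntegers K) :
      (minpoly ℤ (β : K)).natDegree ≤ finrank ℚ K := by
    have h := minpoly.natDegree_le (A := ℚ) (β : K)
    rwa [minpoly.isIntegrallyClosed_eq_field_fractions' ℚ β.isIntegral_coe,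
      (minpoly.monic β.isIntegral_coe).natDegree_map] at h
  have hfin : S.Finite := by
    refine ((finite_mahlerMeasure_le (finrank ℚ K) (mahler α).toNNReal).image
      fun p : ℤ[X] => (p.map (Int.castRingHom ℂ)).mahlerMeasure).subset ?_
    rintro _ ⟨⟨β, -, -, rfl⟩, hβ⟩
    exact ⟨minpoly ℤ (β : K), ⟨hdeg β, le_trans hβ (Real.le_coe_toNNReal _)⟩, rfl⟩
  have hmem : mahler α ∈ S := ⟨⟨α, hα, h1, rfl⟩, le_refl (mahler α)⟩
  obtain ⟨m, hm⟩ := hfin.exists_minimal ⟨_, hmem⟩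
  refine ⟨m, ⟨hm.1.1, fun x hx => ?_⟩, hm.1.2⟩
  rcases le_total x m with h | h
  · exact hm.2 ⟨hx, h.trans hm.1.2⟩ h
  · exact h

/-- Fields with unbounded discriminants are infinitely many up to isomorphism. -/
lemma infinitelyManyFields_of_unbounded
    {P : (K : IntermediateField ℚ ℂ) → [NumberField K] → Prop}
    (h : ∀ B : ℝ, ∃ (K : IntermediateField ℚ ℂ) (_ : NumberField K), P K ∧ B < absDiscr K) :
    InfinitelyManyFields P := by
  choose G hG hP hB using h
  -- Each term is the discriminant of the field chosen to exceed the previous term, so `G (d k)` has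
  -- discriminant `d (k + 1)`.
  let d : ℕ → ℝ := fun k => Nat.rec 0 (fun _ x => @absDiscr (G x) _ (hG x)) k
  have hd : StrictMono d := strictMono_nat_of_lt_succ fun k => hB (d k)
  refine ⟨fun k => G (d k), fun k => ⟨hG _, hP _⟩, fun i j hij => ⟨fun f => hij ?_⟩⟩
  have := hG (d i)
  have := hG (d j)
  have hf := NumberField.discr_eq_discr_of_ringEquiv (G (d i)) f
  have hsucc : d (i + 1) = d (j + 1) := by
    change absDiscr (G (d i)) = absDiscr (G (d j))
    rw [absDiscr, absDiscr, hf]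
  exact Nat.succ_injective (hd.injective hsucc)

/-- As `e > 1/4`, the factor `|D| ^ (e - 1/4)` eventually exceeds `C / c`. -/
lemma exponentQuarterIsSharp_of_unbounded
    {T : (K : IntermediateField ℚ ℂ) → [NumberField K] → Prop} {C : ℝ}
    (h : ∀ B : ℝ, ∃ (K : IntermediateField ℚ ℂ) (_ : NumberField K),
      (T K ∧ ∃ m, HasMinIntegralMahler K m ∧ m ≤ C * absDiscr K ^ (1 / 4 : ℝ)) ∧
        B < absDiscr K) :
    ExponentQuarterIsSharp T := by
  intro c e hc he
  obtain ⟨B, hB⟩ := Filter.eventually_atTop.mp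
    ((tendsto_rpow_atTop (sub_pos.mpr he)).eventually_gt_atTop (C / c))
  obtain ⟨K, hK, ⟨hT, m, hm, hle⟩, hD⟩ := h (max B 1)
  refine ⟨K, hK, hT, m, hm, hle.trans_lt ?_⟩
  have hpos : 0 < absDiscr K := by linarith [le_max_right B 1]
  have h1 := hB _ ((le_max_left B 1).trans hD.le)
  rw [div_lt_iff₀ hc] at h1
  calc C * absDiscr K ^ (1 / 4 : ℝ)
      < absDiscr K ^ (e - 1 / 4) * c * absDiscr K ^ (1 / 4 : ℝ) :=
        mul_lt_mul_of_pos_right h1 (Real.rpow_pos_of_pos hpos _)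
    _ = c * (absDiscr K ^ (e - 1 / 4) * absDiscr K ^ (1 / 4 : ℝ)) := by ring
    _ = c * absDiscr K ^ e := by rw [← Real.rpow_add hpos]; congr 2; ring

lemma lt_mul_rpow_quarter {x c D : ℝ} (hc : 0 ≤ c) (hD : 0 ≤ D)
    (h : x ^ 4 < c ^ 4 * D) : x < c * D ^ (1 / 4 : ℝ) := by
  refine lt_of_pow_lt_pow_left₀ 4 (by positivity) ?_
  rwa [mul_pow, ← Real.rpow_natCast (D ^ (1 / 4 : ℝ)), ← Real.rpow_mul hD,
    show (1 / 4 : ℝ) * ((4 : ℕ) : ℝ) = 1 by norm_num, Real.rpow_one]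

/-! ### Polynomial discriminant, field discriminant and the index of `ℤ[α]` -/

lemma Cubic.vieta_of_three_roots {F : Type*} [Field F] {b c d x y z : F}
    (hx : x ^ 3 + b * x ^ 2 + c * x + d = 0) (hy : y ^ 3 + b * y ^ 2 + c * y + d = 0)
    (hz : z ^ 3 + b * z ^ 2 + c * z + d = 0) (hxy : x ≠ y) (hxz : x ≠ z) (hyz : y ≠ z) :
    b = -(x + y + z) ∧ c = x * y + x * z + y * z ∧ d = -(x * y * z) := by
  have h1 : x ^ 2 + x * y + y ^ 2 + b * (x + y) + c = 0 :=
    mul_left_cancel₀ (sub_ne_zero.mpr hxy) (by linear_combination hx - hy)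
  have h2 : x ^ 2 + x * z + z ^ 2 + b * (x + z) + c = 0 :=
    mul_left_cancel₀ (sub_ne_zero.mpr hxz) (by linear_combination hx - hz)
  have hb : b = -(x + y + z) :=
    mul_left_cancel₀ (sub_ne_zero.mpr hyz) (by linear_combination h1 - h2)
  have hc : c = x * y + x * z + y * z := by rw [hb] at h1; linear_combination h1
  exact ⟨hb, hc, by rw [hb, hc] at hx; linear_combination hx⟩

lemma Cubic.aeval_toPoly {A : Type*} [CommRing A] (P : Cubic ℤ) (x : A) :
    aeval x P.toPoly = P.a * x ^ 3 + P.b * x ^ 2 + P.c * x + P.d := by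
  simp [Cubic.toPoly]

section Index

variable {K : Type*} [Field K] {α : K} {P : Cubic ℤ}

lemma root_of_minpoly_cubic (ha : P.a = 1) (hmin : minpoly ℤ α = P.toPoly) {L : Type*} [Field L]
    (f : K →+* L) : f α ^ 3 + P.b * f α ^ 2 + P.c * f α + P.d = 0 := by
  have h := minpoly.aeval ℤ α
  rw [hmin, Cubic.aeval_toPoly, ha] at h
  have h' := congrArg f h
  simpa using h'

variable [NumberField K]

lemma adjoin_eq_top_of_minpoly_cubic (ha : P.a = 1) (hα : IsIntegral ℤ α)
    (hmin : minpoly ℤ α = P.toPoly) (h3 : finrank ℚ K = 3) :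
    IntermediateField.adjoin ℚ {α} = ⊤ := by
  rw [Field.primitive_element_iff_minpoly_natDegree_eq,
    minpoly.isIntegrallyClosed_eq_field_fractions' ℚ hα, (minpoly.monic hα).natDegree_map, hmin,
    h3, Cubic.natDegree_of_a_ne_zero (by simp [ha])]

lemma algHom_ext_of_adjoin_simple_eq_top (htop : IntermediateField.adjoin ℚ {α} = ⊤) {L : Type*}
    [Field L] [Algebra ℚ L] {f g : K →ₐ[ℚ] L} (h : f α = g α) : f = g := by
  refine AlgHom.ext_of_adjoin_eq_top (s := {α}) ?_ (by simpa using h)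
  rw [← IntermediateField.adjoin_simple_toSubalgebra_of_isAlgebraic
    (Algebra.IsAlgebraic.isAlgebraic α), htop, IntermediateField.top_toSubalgebra]

/-- The left side is the squared Vandermonde determinant of the three conjugates, which are distinct
because an embedding is determined by its value at a generator. Vieta's formulas turn it into the
discriminant in the coefficients. -/
lemma discr_pow_eq_cubic_discr (ha : P.a = 1) (hα : IsIntegral ℤ α)
    (hmin : minpoly ℤ α = P.toPoly) (h3 : finrank ℚ K = 3) :
    Algebra.discr ℚ (fun i : Fin 3 => α ^ (i : ℕ)) = (P.discr : ℚ) := by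
  have htop := adjoin_eq_top_of_minpoly_cubic ha hα hmin h3
  have hcard : Fintype.card (Fin 3) = Fintype.card (K →ₐ[ℚ] ℂ) := by
    rw [AlgHom.card ℚ K ℂ, h3, Fintype.card_fin]
  let e : Fin 3 ≃ (K →ₐ[ℚ] ℂ) := Fintype.equivOfCardEq hcard
  have hne : ∀ i j, i ≠ j → e i α ≠ e j α := fun i j hij h =>
    hij (e.injective (algHom_ext_of_adjoin_simple_eq_top htop h))
  have hroot (i : Fin 3) := root_of_minpoly_cubic ha hmin (e i : K →+* ℂ)
  obtain ⟨hb, hc, hd⟩ := Cubic.vieta_of_three_roots (hroot 0) (hroot 1) (hroot 2)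
    (hne 0 1 (by decide)) (hne 0 2 (by decide)) (hne 1 2 (by decide))
  apply (algebraMap ℚ ℂ).injective
  rw [Algebra.discr_eq_det_embeddingsMatrixReindex_pow_two ℚ ℂ _ e, Matrix.det_fin_three]
  simp only [Algebra.embeddingsMatrixReindex, Algebra.embeddingsMatrix, Matrix.reindex_apply,
    Matrix.submatrix_apply, Matrix.of_apply, Equiv.symm_symm, Equiv.refl_symm, Equiv.refl_apply,
    Fin.val_zero, Fin.val_one, Fin.val_two, map_pow, Cubic.discr, ha, eq_ratCast]
  push_cast
  simp only [RingHom.coe_coe] at hb hc hd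
  rw [hb, hc, hd]
  ring

/-- The discriminant of a cubic is the discriminant of the field times the square of an index, and
each prime divisor of the index is detected by an integer outside `ℤ[α]`. -/
lemma exists_index_cubic (ha : P.a = 1) (hα : IsIntegral ℤ α)
    (hmin : minpoly ℤ α = P.toPoly) (h3 : finrank ℚ K = 3) :
    ∃ i : ℤ, P.discr = i ^ 2 * NumberField.discr K ∧ ∀ p : ℕ, p.Prime → (p : ℤ) ∣ i →
      ∃ z : K, IsIntegral ℤ z ∧ (p : ℤ) • z ∈ Algebra.adjoin ℤ {α} ∧
        z ∉ Algebra.adjoin ℤ {α} := by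
  let a : NumberField.RingOfIntegers K := ⟨α, hα⟩
  have hcard : Fintype.card (Free.ChooseBasisIndex ℤ (NumberField.RingOfIntegers K)) =
      Fintype.card (Fin 3) := by
    rw [← finrank_eq_card_chooseBasisIndex, NumberField.RingOfIntegers.rank, h3, Fintype.card_fin]
  let f := Fintype.equivOfCardEq hcard
  let b := (NumberField.RingOfIntegers.basis K).reindex f
  let M : Matrix (Fin 3) (Fin 3) ℤ := b.toMatrix fun i : Fin 3 => a ^ (i : ℕ)
  have hM (i : Fin 3) : α ^ (i : ℕ) = ∑ j, (M j i : K) * (b j : K) := by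
    have h := b.sum_toMatrix_smul_self (fun i : Fin 3 => a ^ (i : ℕ)) i
    have h' := congrArg (algebraMap (NumberField.RingOfIntegers K) K) h
    simp only [map_sum, map_pow, zsmul_eq_mul, map_mul, map_intCast] at h'
    exact h'.symm
  refine ⟨M.det, ?_, fun p hp hdvd => ?_⟩
  · have hb : Algebra.discr ℚ (fun j => (b j : K)) = NumberField.discr K := by
      rw [NumberField.coe_discr, ← Algebra.discr_reindex ℚ (NumberField.integralBasis K) f]
      congr 1
      ext j
      simp [b, NumberField.integralBasis_apply]
    have hv : (fun i : Fin 3 => α ^ (i : ℕ)) = Matrix.vecMul (fun j => (b j : K))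
        ((M.map (Int.castRingHom ℚ)).map (algebraMap ℚ K)) := by
      ext i
      rw [hM i]
      simp [Matrix.vecMul, dotProduct, mul_comm]
    have h := discr_pow_eq_cubic_discr ha hα hmin h3
    rw [hv, Algebra.discr_of_matrix_vecMul, hb] at h
    have hdet : (M.map (Int.castRingHom ℚ)).det = (M.det : ℚ) :=
      ((Int.castRingHom ℚ).map_det M).symm
    rw [hdet] at h
    exact_mod_cast h.symm
  · have := Fact.mk hp
    have hdet : (M.map (Int.castRingHom (ZMod p))).det = 0 := by
      have h := (Int.castRingHom (ZMod p)).map_det M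
      rw [RingHom.mapMatrix_apply] at h
      rw [← h, eq_intCast, ZMod.intCast_zmod_eq_zero_iff_dvd]
      exact hdvd
    -- A kernel vector modulo `p`, lifted to `ℤ`, gives a combination of powers of `α` lying in `p
    -- 𝓞`; its quotient by `p` is the required `z`.
    obtain ⟨v, hv0, hv⟩ := Matrix.exists_mulVec_eq_zero_iff.mpr hdet
    let w : Fin 3 → ℤ := fun i => (v i).val
    have hw (i) : ((w i : ℤ) : ZMod p) = v i := by simp [w]
    have hdiv (j) : ∃ q : ℤ, ∑ i, M j i * w i = p * q := by
      have h := congrFun hv j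
      simp only [Matrix.mulVec, dotProduct, Matrix.map_apply, Pi.zero_apply, eq_intCast] at h
      have h' : ((∑ i, M j i * w i : ℤ) : ZMod p) = 0 := by
        push_cast; simpa [w] using h
      exact (ZMod.intCast_zmod_eq_zero_iff_dvd _ p).mp h'
    choose q hq using hdiv
    have hz : (p : ℤ) • (∑ j, (q j : K) * (b j : K)) = ∑ i : Fin 3, (w i : K) * α ^ (i : ℕ) := by
      simp only [hM, Finset.mul_sum]
      rw [Finset.sum_comm, zsmul_eq_mul, Finset.mul_sum]
      refine Finset.sum_congr rfl fun j _ => ?_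
      have h := congrArg (Int.cast : ℤ → K) (hq j)
      push_cast at h
      rw [Int.cast_natCast, ← mul_assoc, ← h, Finset.sum_mul]
      exact Finset.sum_congr rfl fun i _ => by ring
    have hαmem : α ∈ Algebra.adjoin ℤ {α} := Algebra.self_mem_adjoin_singleton ℤ α
    refine ⟨∑ j, (q j : K) * (b j : K), ?_, ?_, fun hmem => ?_⟩
    · exact IsIntegral.sum _ fun j _ => (isIntegral_algebraMap (R := ℤ) (x := q j)).mul
        (b j).isIntegral_coe
    · rw [hz]
      exact Subalgebra.sum_mem _ fun i _ => Subalgebra.mul_mem _ (Subalgebra.intCast_mem _ _)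
        (Subalgebra.pow_mem _ hαmem _)
    · obtain ⟨g, hg⟩ := Algebra.adjoin_mem_exists_aeval ℤ α hmem
      have hmonic := minpoly.monic hα
      have hdeg : (minpoly ℤ α).degree = 3 := by
        rw [hmin, Cubic.degree_of_a_ne_zero (by simp [ha])]
      set r := g %ₘ minpoly ℤ α
      have hr : aeval α r = aeval α g := minpoly.aeval_modByMonic_minpoly g α
      have hrdeg : r.degree < 3 := hdeg ▸ degree_modByMonic_lt g hmonic
      set W : ℤ[X] := ∑ i : Fin 3, C (w i) * X ^ (i : ℕ)
      have hWdeg : W.degree < 3 := degree_sum_fin_lt w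
      -- If `z = r(α)` with `deg r < 3`, then `p r` and `W` agree at `α` and have degree below 3, so
      -- they coincide. The lifted vector would then vanish modulo `p`.
      have hzero : C (p : ℤ) * r - W = 0 := by
        refine eq_zero_of_dvd_of_degree_lt (minpoly.isIntegrallyClosed_dvd hα ?_) ?_
        · rw [map_sub, map_mul, hr, hg, sub_eq_zero]
          simpa [W] using hz
        · rw [hdeg]
          refine (degree_sub_le _ _).trans_lt (max_lt ?_ hWdeg)
          rw [← smul_eq_C_mul]
          exact (degree_smul_le (p : ℤ) r).trans_lt hrdeg
      apply hv0
      ext i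
      have hcoeff := congrArg (fun s : ℤ[X] => ((s.coeff i : ℤ) : ZMod p)) hzero
      have hWc : W.coeff i = w i := by
        simp [W, finsetSum_coeff, coeff_X_pow, Fin.val_inj]
      simpa [hWc, hw] using hcoeff

/-- If `ℤ[α]` is maximal at every prime whose square divides the discriminant of the minimal
polynomial of `α`, then that discriminant is the discriminant of the field. -/
lemma numberField_discr_eq_cubic_discr (ha : P.a = 1) (hα : IsIntegral ℤ α)
    (hmin : minpoly ℤ α = P.toPoly) (h3 : finrank ℚ K = 3)
    (h : ∀ p : ℕ, p.Prime → (p : ℤ) ^ 2 ∣ P.discr → ∀ z : K, IsIntegral ℤ z →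
      (p : ℤ) • z ∈ Algebra.adjoin ℤ {α} → z ∈ Algebra.adjoin ℤ {α}) :
    NumberField.discr K = P.discr := by
  obtain ⟨i, hi, hz⟩ := exists_index_cubic ha hα hmin h3
  have hunit : i.natAbs = 1 := by
    by_contra hne
    obtain ⟨p, hp, hpi⟩ := Nat.exists_prime_and_dvd hne
    have hpi : (p : ℤ) ∣ i := Int.natCast_dvd.mpr hpi
    obtain ⟨z, hzint, hmem, hnot⟩ := hz p hp hpi
    exact hnot (h p hp (hi ▸ (pow_dvd_pow_of_dvd hpi 2).mul_right _) z hzint hmem)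
  rw [hi, ← Int.natAbs_sq i, hunit]
  simp

lemma mem_adjoin_of_prime_smul_mem_of_eisenstein_cubic (ha : P.a = 1) (hα : IsIntegral ℤ α)
    (hmin : minpoly ℤ α = P.toPoly) (h3 : finrank ℚ K = 3) {p : ℕ} (hp : p.Prime)
    (hb : (p : ℤ) ∣ P.b) (hc : (p : ℤ) ∣ P.c) (hd : (p : ℤ) ∣ P.d) (hd' : ¬ (p : ℤ) ^ 2 ∣ P.d)
    {z : K} (hz : IsIntegral ℤ z) (hpz : (p : ℤ) • z ∈ Algebra.adjoin ℤ {α}) :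
    z ∈ Algebra.adjoin ℤ {α} := by
  have hp' : Prime (p : ℤ) := Nat.prime_iff_prime_int.mp hp
  have htop : Algebra.adjoin ℚ {α} = ⊤ := by
    rw [← IntermediateField.adjoin_simple_toSubalgebra_of_isAlgebraic
      (Algebra.IsAlgebraic.isAlgebraic α), adjoin_eq_top_of_minpoly_cubic ha hα hmin h3,
      IntermediateField.top_toSubalgebra]
  let B := PowerBasis.ofAdjoinEqTop (Algebra.IsIntegral.isIntegral (R := ℚ) α) htop
  have hB : B.gen = α := PowerBasis.ofAdjoinEqTop_gen _ _
  have key := mem_adjoin_of_smul_prime_smul_of_minpoly_isEisensteinAt (B := B) hp'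
    (by rwa [hB]) hz (by rwa [hB])
  rw [hB] at key
  refine key ((minpoly.monic hα).isEisensteinAt_of_mem_of_notMem ?_ (fun {n} hn => ?_) ?_)
  · rw [Ne, Ideal.span_singleton_eq_top]
    exact hp'.not_isUnit
  · rw [hmin] at hn ⊢
    rw [Cubic.natDegree_of_a_ne_zero (by simp [ha])] at hn
    rw [Ideal.mem_span_singleton]
    interval_cases n
    · simpa using hd
    · simpa using hc
    · simpa using hb
  · rw [hmin, Ideal.span_singleton_pow, Ideal.mem_span_singleton, Cubic.coeff_eq_d]
    exact hd'

end Index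

/-! ### Monic integral cubics: irreducibility, Mahler measure, root fields -/

/-- A reducible monic cubic has an integer root, but modulo 2 the values at 0 and 1 are both 1. -/
lemma Cubic.irreducible_toPoly_of_odd {P : Cubic ℤ} (ha : P.a = 1) (hd : Odd P.d)
    (hbc : Odd (P.b + P.c)) : Irreducible P.toPoly := by
  have hdeg : P.toPoly.natDegree = 3 := Cubic.natDegree_of_a_ne_zero (by simp [ha])
  rw [(Cubic.monic_of_a_eq_one ha).irreducible_iff_roots_eq_zero_of_degree_le_three
    (by omega) (by omega), Multiset.eq_zero_iff_forall_notMem]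
  intro r hr
  have h : r ^ 3 + P.b * r ^ 2 + P.c * r + P.d = 0 := by
    have h := (mem_roots'.mp hr).2
    simpa [Cubic.toPoly, ha] using h
  have h2 := congrArg (Int.cast : ℤ → ZMod 2) h
  have hd2 := (ZMod.intCast_eq_one_iff_odd).mpr hd
  have hbc2 := (ZMod.intCast_eq_one_iff_odd).mpr hbc
  push_cast at h2 hd2 hbc2
  generalize (P.b : ZMod 2) = b at *
  generalize (P.c : ZMod 2) = c at *
  generalize (P.d : ZMod 2) = d at *
  generalize (r : ZMod 2) = r at *
  revert b c d r
  decide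

lemma Cubic.isIntegral_of_root {P : Cubic ℤ} (ha : P.a = 1) {L : Type*} [Field L] {x : L}
    (hx : x ^ 3 + P.b * x ^ 2 + P.c * x + P.d = 0) : IsIntegral ℤ x := by
  refine ⟨P.toPoly, Cubic.monic_of_a_eq_one ha, ?_⟩
  rw [← aeval_def, Cubic.aeval_toPoly, ha]
  simpa using hx

lemma Cubic.minpoly_eq_toPoly {P : Cubic ℤ} (ha : P.a = 1) (hirr : Irreducible P.toPoly)
    {L : Type*} [Field L] [CharZero L] {x : L}
    (hx : x ^ 3 + P.b * x ^ 2 + P.c * x + P.d = 0) : minpoly ℤ x = P.toPoly := by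
  have hmonic := Cubic.monic_of_a_eq_one ha
  have hQ : Irreducible (P.toPoly.map (algebraMap ℤ ℚ)) :=
    (hmonic.irreducible_iff_irreducible_map_fraction_map).mp hirr
  have h := minpoly.eq_of_irreducible_of_monic hQ (x := x) (by
    rw [aeval_map_algebraMap, Cubic.aeval_toPoly, ha]; simpa using hx) (hmonic.map _)
  rw [minpoly.isIntegrallyClosed_eq_field_fractions' ℚ (Cubic.isIntegral_of_root ha hx)] at h
  exact (map_injective _ (algebraMap ℤ ℚ).injective_int h).symm

lemma Cubic.mahlerMeasure_toPoly {P : Cubic ℤ} (ha : P.a = 1) {x y z : ℂ}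
    (hb : (P.b : ℂ) = -(x + y + z)) (hc : (P.c : ℂ) = x * y + x * z + y * z)
    (hd : (P.d : ℂ) = -(x * y * z)) :
    (P.toPoly.map (Int.castRingHom ℂ)).mahlerMeasure = max 1 ‖x‖ * max 1 ‖y‖ * max 1 ‖z‖ := by
  have h : P.toPoly.map (Int.castRingHom ℂ) = (X - C x) * (X - C y) * (X - C z) := by
    rw [Cubic.prod_X_sub_C_eq, ← Cubic.map_toPoly]
    simp [Cubic.map, ha, hb, hc, hd]
  rw [h, mahlerMeasure_mul, mahlerMeasure_mul, mahlerMeasure_X_sub_C, mahlerMeasure_X_sub_C,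
    mahlerMeasure_X_sub_C]

section RootField

variable {P : Cubic ℤ} {α : ℂ}

lemma Cubic.numberField_adjoin (ha : P.a = 1) (hα : α ^ 3 + P.b * α ^ 2 + P.c * α + P.d = 0) :
    NumberField (IntermediateField.adjoin ℚ {α}) :=
  have := IntermediateField.adjoin.finiteDimensional
    ((Cubic.isIntegral_of_root ha hα).tower_top (A := ℚ))
  ⟨⟩

lemma Cubic.gen_root (hα : α ^ 3 + P.b * α ^ 2 + P.c * α + P.d = 0) :
    IntermediateField.AdjoinSimple.gen ℚ α ^ 3 + P.b * IntermediateField.AdjoinSimple.gen ℚ α ^ 2 +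
      P.c * IntermediateField.AdjoinSimple.gen ℚ α + P.d = 0 := by
  apply (algebraMap (IntermediateField.adjoin ℚ {α}) ℂ).injective
  simpa using hα

lemma Cubic.finrank_adjoin (ha : P.a = 1) (hirr : Irreducible P.toPoly)
    (hα : α ^ 3 + P.b * α ^ 2 + P.c * α + P.d = 0) :
    finrank ℚ (IntermediateField.adjoin ℚ {α}) = 3 := by
  have hint := Cubic.isIntegral_of_root ha hα
  rw [IntermediateField.adjoin.finrank (hint.tower_top (A := ℚ)),
    minpoly.isIntegrallyClosed_eq_field_fractions' ℚ hint, (minpoly.monic hint).natDegree_map,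
    Cubic.minpoly_eq_toPoly ha hirr hα, Cubic.natDegree_of_a_ne_zero (by simp [ha])]

lemma Cubic.exists_hasMinIntegralMahler_le (ha : P.a = 1) (hirr : Irreducible P.toPoly)
    (hα : α ^ 3 + P.b * α ^ 2 + P.c * α + P.d = 0) {x y z : ℂ}
    (hb : (P.b : ℂ) = -(x + y + z)) (hc : (P.c : ℂ) = x * y + x * z + y * z)
    (hd : (P.d : ℂ) = -(x * y * z)) (h1 : max 1 ‖x‖ * max 1 ‖y‖ * max 1 ‖z‖ ≠ 1) :
    ∃ m, HasMinIntegralMahler (IntermediateField.adjoin ℚ {α}) m ∧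
      m ≤ max 1 ‖x‖ * max 1 ‖y‖ * max 1 ‖z‖ := by
  have := Cubic.numberField_adjoin ha hα
  have hroot := Cubic.gen_root hα
  let a : NumberField.RingOfIntegers (IntermediateField.adjoin ℚ {α}) :=
    ⟨IntermediateField.AdjoinSimple.gen ℚ α, Cubic.isIntegral_of_root ha hroot⟩
  have hmin := Cubic.minpoly_eq_toPoly ha hirr hroot
  have hmahler : mahler a = max 1 ‖x‖ * max 1 ‖y‖ * max 1 ‖z‖ := by
    rw [← Cubic.mahlerMeasure_toPoly ha hb hc hd, ← hmin]
    rfl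
  have htop := adjoin_eq_top_of_minpoly_cubic ha (Cubic.isIntegral_of_root ha hroot) hmin
    (Cubic.finrank_adjoin ha hirr hα)
  rw [← hmahler] at h1 ⊢
  exact _root_.exists_hasMinIntegralMahler_le a htop h1

end RootField

/-! ### Distinguishing the three types of cubic field -/

section Types

variable {K : Type*} [Field K] {α : K}

lemma not_isTotallyReal_of_embedding (f : K →+* ℂ) (h : starRingEnd ℂ (f α) ≠ f α) :
    ¬ NumberField.IsTotallyReal K := by
  intro hK
  have hv := hK.isReal (NumberField.InfinitePlace.mk f)
  rw [NumberField.InfinitePlace.isReal_mk_iff, NumberField.ComplexEmbedding.isReal_iff] at hv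
  exact h (DFunLike.congr_fun hv α)

variable [NumberField K]

lemma isTotallyReal_of_forall_embedding_conj (htop : IntermediateField.adjoin ℚ {α} = ⊤)
    (h : ∀ f : K →+* ℂ, starRingEnd ℂ (f α) = f α) : NumberField.IsTotallyReal K := by
  refine ⟨fun v => NumberField.InfinitePlace.isReal_iff.mpr ?_⟩
  rw [NumberField.ComplexEmbedding.isReal_iff]
  have := algHom_ext_of_adjoin_simple_eq_top htop
    (f := (NumberField.ComplexEmbedding.conjugate v.embedding).toRatAlgHom)
    (g := v.embedding.toRatAlgHom) (h v.embedding)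
  ext x
  exact DFunLike.congr_fun this x

/-- The discriminant of the minimal polynomial of a generator of a Galois cubic field is a
square. -/
lemma isSquare_discr_of_isGalois {P : Cubic ℤ} (ha : P.a = 1) (hα : IsIntegral ℤ α)
    (hmin : minpoly ℤ α = P.toPoly) (h3 : finrank ℚ K = 3) (hK : IsGalois ℚ K) :
    IsSquare (P.discr : ℚ) := by
  let Q : Cubic ℚ := P.map (Int.castRingHom ℚ)
  have hQa : Q.a ≠ 0 := by simp [Q, Cubic.map, ha]
  have hQ : Q.toPoly = minpoly ℚ α := by
    rw [minpoly.isIntegrallyClosed_eq_field_fractions' ℚ hα, hmin, Cubic.map_toPoly]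
    rfl
  have hsplit : (Q.toPoly.map (algebraMap ℚ K)).Splits := by
    rw [hQ]
    exact hK.to_normal.splits α
  obtain ⟨x, y, z, hxyz⟩ := (Cubic.splits_iff_roots_eq_three hQa).mp hsplit
  have hdisc := Cubic.discr_eq_prod_three_roots hQa hxyz
  set δ := algebraMap ℚ K Q.a * algebraMap ℚ K Q.a * (x - y) * (x - z) * (y - z)
  have hQd : Q.discr = (P.discr : ℚ) := by
    simp [Q, Cubic.discr, Cubic.map]
  rw [hQd] at hdisc
  have hint : IsIntegral ℚ δ := Algebra.IsIntegral.isIntegral δ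
  -- The square root `δ` of the discriminant lies in `K`. Its degree is at most 2 and divides 3, so
  -- it is rational.
  have hle : (minpoly ℚ δ).natDegree ≤ 2 := by
    have h := natDegree_le_of_dvd (minpoly.dvd ℚ δ (p := X ^ 2 - C (P.discr : ℚ))
      (by simp [← hdisc])) (X_pow_sub_C_ne_zero two_pos _)
    rwa [natDegree_X_pow_sub_C] at h
  have hdvd : (minpoly ℚ δ).natDegree ∣ 3 := h3 ▸ minpoly.degree_dvd hint
  have hone : (minpoly ℚ δ).natDegree = 1 :=
    ((Nat.dvd_prime Nat.prime_three).mp hdvd).resolve_right (by omega)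
  obtain ⟨q, hq⟩ := minpoly.natDegree_eq_one_iff.mp hone
  refine ⟨q, (algebraMap ℚ K).injective ?_⟩
  rw [hdisc, map_mul, hq, sq]

end Types

/-! ### Field discriminants of the three families -/

section Maximality

variable {K : Type*} [Field K] {α : K}

/-- Up to powers of three, `ℤ[α]` is contained in `ℤ[3 α + n]`. -/
lemma exists_three_pow_smul_mem_adjoin (n : ℤ) {z : K} (hz : z ∈ Algebra.adjoin ℤ {α}) :
    ∃ k : ℕ, (3 ^ k : ℤ) • z ∈ Algebra.adjoin ℤ {3 * α + n} := by
  have hβ : 3 * α + n ∈ Algebra.adjoin ℤ {3 * α + (n : K)} := Algebra.self_mem_adjoin_singleton _ _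
  induction hz using Algebra.adjoin_induction with
  | mem x hx =>
    rw [Set.mem_singleton_iff.mp hx]
    refine ⟨1, ?_⟩
    have h := sub_mem hβ (Subalgebra.intCast_mem _ n)
    simpa using h
  | algebraMap r => exact ⟨0, by simp⟩
  | add x y _ _ hx hy =>
    obtain ⟨k, hk⟩ := hx
    obtain ⟨l, hl⟩ := hy
    refine ⟨k + l, ?_⟩
    have h := add_mem (Subalgebra.smul_mem _ hk ((3 : ℤ) ^ l))
      (Subalgebra.smul_mem _ hl ((3 : ℤ) ^ k))
    convert h using 1
    simp only [smul_smul, smul_add, pow_add, mul_comm]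
  | mul x y _ _ hx hy =>
    obtain ⟨k, hk⟩ := hx
    obtain ⟨l, hl⟩ := hy
    refine ⟨k + l, ?_⟩
    have h := mul_mem hk hl
    rwa [smul_mul_smul_comm, ← pow_add] at h

variable [NumberField K]

/-- The sign `s` treats both families `x³ ± n x² + n` at once. At primes dividing `n = 12 t + 1` the
cubic is Eisenstein. At any other prime `p²` would have to divide `(2n)² + 27 s`, which is prime to
6 and free of larger prime squares. -/
lemma discr_eq_of_cubic_sq_add {t : ℕ} {s : ℤ} (hs : s = 1 ∨ s = -1)
    (ht : ∀ p : ℕ, p.Prime → 5 ≤ p →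
      ¬ p ^ 2 ∣ 12 * t + 1 ∧ ¬ (p : ℤ) ^ 2 ∣ (24 * t + (2 : ℕ)) ^ 2 + 27 * s)
    (hα : IsIntegral ℤ α) (h3 : finrank ℚ K = 3)
    (hmin : minpoly ℤ α = (⟨1, s * (12 * t + 1), 0, 12 * t + 1⟩ : Cubic ℤ).toPoly) :
    NumberField.discr K = -s * (12 * t + 1) ^ 2 * ((24 * t + 2) ^ 2 + 27 * s) := by
  have hdisc : (⟨1, s * (12 * t + 1), 0, 12 * t + 1⟩ : Cubic ℤ).discr =
      -s * (12 * t + 1) ^ 2 * ((24 * t + 2) ^ 2 + 27 * s) := by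
    rcases hs with rfl | rfl <;> simp only [Cubic.discr] <;> ring
  rw [← hdisc]
  refine numberField_discr_eq_cubic_discr rfl hα hmin h3 fun p hp hdvd z hz hpz => ?_
  have hp' : Prime (p : ℤ) := Nat.prime_iff_prime_int.mp hp
  have hp5 : p ≠ 2 → p ≠ 3 → 5 ≤ p := fun h2 h3 => by
    have := hp.two_le
    have : p ≠ 4 := by rintro rfl; revert hp; decide
    omega
  by_cases hpn : (p : ℤ) ∣ 12 * t + 1
  · have hp5 : 5 ≤ p := hp5 (by rintro rfl; push_cast at hpn; omega)
      (by rintro rfl; push_cast at hpn; omega)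
    refine mem_adjoin_of_prime_smul_mem_of_eisenstein_cubic rfl hα hmin h3 hp
      (hpn.mul_left _) (dvd_zero _) hpn (fun h => (ht p hp hp5).1 ?_) hz hpz
    have h : (p : ℤ) ^ 2 ∣ 12 * t + 1 := h
    exact_mod_cast h
  · exfalso
    rw [hdisc] at hdvd
    have hcop : IsCoprime ((p : ℤ) ^ 2) (-s * (12 * t + 1) ^ 2) := by
      refine IsCoprime.pow_left (IsCoprime.mul_right ?_
        (hp'.coprime_iff_not_dvd.mpr hpn).pow_right)
      rcases hs with rfl | rfl
      · exact isCoprime_one_right.neg_right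
      · simpa using isCoprime_one_right
    have hdvd' := hcop.dvd_of_dvd_mul_left hdvd
    have hp1 : (p : ℤ) ∣ (24 * t + 2) ^ 2 + 27 * s := (dvd_pow_self _ two_ne_zero).trans hdvd'
    refine (ht p hp (hp5 ?_ ?_)).2 (by exact_mod_cast hdvd')
    · rintro rfl
      rw [show (24 * (t : ℤ) + 2) ^ 2 = 2 * (288 * t ^ 2 + 48 * t + 2) by ring] at hp1
      push_cast at hp1
      rcases hs with rfl | rfl <;> omega
    · rintro rfl
      rw [show (24 * (t : ℤ) + 2) ^ 2 = 3 * (192 * t ^ 2 + 32 * t + 1) + 1 by ring] at hp1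
      push_cast at hp1
      rcases hs with rfl | rfl <;> omega

/-- The discriminant is `N²` with `N = n² + 3n + 9`, so every prime factor of `N` needs care. The
element `3α + n` is a root of `y³ - 3N y + (2n + 3) N`. This is Eisenstein at `p ∣ N`: a common
factor of `N` and `2n + 3` divides `4N - (2n + 3)² = 27`, while `N` is prime to 6. -/
lemma discr_eq_of_simplest_cubic {t : ℕ}
    (ht : ∀ p : ℕ, p.Prime → 5 ≤ p → ¬ (p : ℤ) ^ 2 ∣ (24 * t + (5 : ℕ)) ^ 2 + 27)
    (hα : IsIntegral ℤ α) (h3 : finrank ℚ K = 3)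
    (hmin : minpoly ℤ α = (⟨1, 12 * t + 1, -(12 * t + 4), 1⟩ : Cubic ℤ).toPoly) :
    NumberField.discr K = ((12 * t + 1) ^ 2 + 3 * (12 * t + 1) + 9) ^ 2 := by
  set n : ℤ := 12 * t + 1 with hn
  set N : ℤ := n ^ 2 + 3 * n + 9 with hN
  have hdisc : (⟨1, n, -(12 * t + 4), 1⟩ : Cubic ℤ).discr = N ^ 2 := by
    rw [hN, hn]; simp only [Cubic.discr]; ring
  rw [← hdisc]
  refine numberField_discr_eq_cubic_discr rfl hα hmin h3 fun p hp hdvd z hz hpz => ?_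
  have hp' : Prime (p : ℤ) := Nat.prime_iff_prime_int.mp hp
  rw [hdisc] at hdvd
  have hpN : (p : ℤ) ∣ N := hp'.dvd_of_dvd_pow ((dvd_pow_self _ two_ne_zero).trans hdvd)
  have hN12 : N = 12 * (12 * t ^ 2 + 5 * t + 1) + 1 := by rw [hN, hn]; ring
  have hp2 : p ≠ 2 := by rintro rfl; rw [hN12] at hpN; push_cast at hpN; omega
  have hp3 : p ≠ 3 := by rintro rfl; rw [hN12] at hpN; push_cast at hpN; omega
  have hp5 : 5 ≤ p := by
    have := hp.two_le
    have : p ≠ 4 := by rintro rfl; revert hp; decide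
    omega
  have hp3' : ¬ (p : ℤ) ∣ 3 := fun h =>
    hp3 ((Nat.prime_dvd_prime_iff_eq hp Nat.prime_three).mp (by exact_mod_cast h))
  have h4N : (24 * (t : ℤ) + (5 : ℕ)) ^ 2 + 27 = 4 * N := by rw [hN, hn]; push_cast; ring
  have hNsq : ¬ (p : ℤ) ^ 2 ∣ N := fun h => ht p hp hp5 (h4N ▸ h.mul_left 4)
  have hlin : ¬ (p : ℤ) ∣ 2 * n + 3 := fun h => by
    have h27 : (p : ℤ) ∣ 3 ^ 3 := by
      have h' := dvd_sub (hpN.mul_left 4) (h.mul_right (2 * n + 3))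
      rwa [show 4 * N - (2 * n + 3) * (2 * n + 3) = 3 ^ 3 by rw [hN]; ring] at h'
    exact hp3' (hp'.dvd_of_dvd_pow h27)
  let Q : Cubic ℤ := ⟨1, 0, -3 * N, (2 * n + 3) * N⟩
  have hαroot := root_of_minpoly_cubic (α := α) (K := K) rfl hmin (RingHom.id K)
  have hβ : (3 * α + n) ^ 3 + Q.b * (3 * α + n) ^ 2 + Q.c * (3 * α + n) + Q.d = 0 := by
    simp only [RingHom.id_apply, hn] at hαroot
    simp only [Q, hN, hn]
    push_cast at hαroot ⊢
    linear_combination 27 * hαroot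
  have hodd : Odd N := ⟨6 * (12 * t ^ 2 + 5 * t + 1), by rw [hN12]; ring⟩
  have hQirr : Irreducible Q.toPoly := by
    refine Cubic.irreducible_toPoly_of_odd rfl ?_ ?_
    · exact Odd.mul ⟨n + 1, by ring⟩ hodd
    · simp only [Q, zero_add]
      exact Odd.mul (by decide) hodd
  obtain ⟨k, hk⟩ := exists_three_pow_smul_mem_adjoin n hpz
  have hkz : (3 ^ k : ℤ) • z ∈ Algebra.adjoin ℤ {3 * α + (n : K)} := by
    refine mem_adjoin_of_prime_smul_mem_of_eisenstein_cubic (P := Q) rfl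
      (Cubic.isIntegral_of_root rfl hβ) (Cubic.minpoly_eq_toPoly rfl hQirr hβ) h3 hp
      (dvd_zero _) (hpN.mul_left _) (hpN.mul_left _) (fun h => hNsq ?_) (hz.smul _) ?_
    · exact ((hp'.coprime_iff_not_dvd.mpr hlin).pow_left).dvd_of_dvd_mul_left h
    · rwa [smul_comm]
  have hle : Algebra.adjoin ℤ {3 * α + (n : K)} ≤ Algebra.adjoin ℤ {α} := by
    rw [Algebra.adjoin_le_iff, Set.singleton_subset_iff]
    have hαm := Algebra.self_mem_adjoin_singleton ℤ α
    exact add_mem (mul_mem (ofNat_mem _ 3) hαm) (Subalgebra.intCast_mem _ n)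
  -- Both `p z` and `3 ^ k z` lie in `ℤ[α]`, and `p` is prime to 3, so a Bézout relation recovers
  -- `z`.
  obtain ⟨u, v, huv⟩ := ((hp'.coprime_iff_not_dvd.mpr hp3').pow_right : IsCoprime (p : ℤ) (3 ^ k))
  have h := add_mem (Subalgebra.smul_mem _ hpz u) (Subalgebra.smul_mem _ (hle hkz) v)
  rwa [smul_smul, smul_smul, ← add_smul, huv, one_smul] at h

end Maximality

/-! ### Locating real roots, and fourth powers of the constants -/

lemma exists_cubic_root_of_neg_pos {b c d u v : ℝ} (huv : u ≤ v)
    (hu : u ^ 3 + b * u ^ 2 + c * u + d < 0) (hv : 0 < v ^ 3 + b * v ^ 2 + c * v + d) :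
    ∃ x, u < x ∧ x < v ∧ x ^ 3 + b * x ^ 2 + c * x + d = 0 := by
  have hcont : Continuous fun x : ℝ => x ^ 3 + b * x ^ 2 + c * x + d := by fun_prop
  obtain ⟨x, hx, h0⟩ := intermediate_value_Ioo huv hcont.continuousOn ⟨hu, hv⟩
  exact ⟨x, hx.1, hx.2, h0⟩

lemma exists_cubic_root_of_pos_neg {b c d u v : ℝ} (huv : u ≤ v)
    (hu : 0 < u ^ 3 + b * u ^ 2 + c * u + d) (hv : v ^ 3 + b * v ^ 2 + c * v + d < 0) :
    ∃ x, u < x ∧ x < v ∧ x ^ 3 + b * x ^ 2 + c * x + d = 0 := by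
  have hcont : Continuous fun x : ℝ => x ^ 3 + b * x ^ 2 + c * x + d := by fun_prop
  obtain ⟨x, hx, h0⟩ := intermediate_value_Ioo' huv hcont.continuousOn ⟨hv, hu⟩
  exact ⟨x, hx.1, hx.2, h0⟩

lemma two_rpow_half_pow_four : ((2 : ℝ) ^ (1 / 2 : ℝ)) ^ 4 = 4 := by
  rw [← Real.rpow_natCast, ← Real.rpow_mul (by norm_num)]
  norm_num

lemma two_rpow_neg_half_pow_four : ((2 : ℝ) ^ (-(1 / 2) : ℝ)) ^ 4 = 1 / 4 := by
  rw [Real.rpow_neg (by norm_num), inv_pow, two_rpow_half_pow_four]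
  norm_num

/-! ### The cyclic family -/

section Simplest

lemma simplestCubic_eq (t : ℕ) : simplestCubic (12 * t + 1) =
    (⟨1, 12 * t + 1, -(12 * t + 4), 1⟩ : Cubic ℚ).toPoly := by
  simp only [simplestCubic, Cubic.toPoly]
  push_cast
  simp only [map_add, map_neg, map_mul, map_one, map_ofNat]
  ring

lemma exists_simplest_root (t : ℕ) : ∃ a : ℝ, 0 < a ∧ a < 1 / 2 ∧
    a ^ 3 + (12 * t + 1) * a ^ 2 + -(12 * t + 4) * a + 1 = 0 := by
  refine exists_cubic_root_of_pos_neg (by norm_num) (by norm_num) ?_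
  have : (0 : ℝ) ≤ t := Nat.cast_nonneg t
  nlinarith

/-- The order-three map `x ↦ 1 / (1 - x)` permutes the roots. Hence one root generates the splitting
field. -/
lemma simplest_vieta {F : Type*} [Field F] {a n : F} (h0 : a ≠ 0) (h1 : 1 - a ≠ 0)
    (ha : a ^ 3 + n * a ^ 2 + -(n + 3) * a + 1 = 0) :
    n = -(a + (1 - a)⁻¹ + (1 - a⁻¹)) ∧
      -(n + 3) = a * (1 - a)⁻¹ + a * (1 - a⁻¹) + (1 - a)⁻¹ * (1 - a⁻¹) ∧
      1 = -(a * (1 - a)⁻¹ * (1 - a⁻¹)) := by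
  refine ⟨?_, ?_, ?_⟩
  · field_simp
    linear_combination -ha
  · field_simp
    linear_combination ha
  · field_simp
    ring

/-- For the root `0 < a < 1/2` the other two have absolute values `1 / (1 - a)` and `1 / a - 1`,
both above 1, so the measure is `1 / a`. It is less than `n + 3`, and `(n + 3)² ≤ 2 (n² + 3n + 9)`.
-/
lemma unbounded_simplestCubic (B : ℝ) : ∃ (K : IntermediateField ℚ ℂ) (_ : NumberField K),
    ((∃ n : ℕ, IsSplittingFieldIn (simplestCubic n) K) ∧ IsCyclicCubic K ∧
      ∃ m, HasMinIntegralMahler K m ∧ m < 2 ^ (1 / 2 : ℝ) * absDiscr K ^ (1 / 4 : ℝ)) ∧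
    B < absDiscr K := by
  obtain ⟨t, htB, ht⟩ := exists_forall_prime_sq_not_dvd 5 (c := 27) (Or.inl rfl) ⌈B⌉₊
  obtain ⟨a, ha0, ha1, haroot⟩ := exists_simplest_root t
  let P : Cubic ℤ := ⟨1, 12 * t + 1, -(12 * t + 4), 1⟩
  have hirr : Irreducible P.toPoly := Cubic.irreducible_toPoly_of_odd rfl odd_one
    (by simp only [P]; exact ⟨-2, by ring⟩)
  have h0 : (a : ℂ) ≠ 0 := by exact_mod_cast ha0.ne'
  have h1 : 1 - (a : ℂ) ≠ 0 := by
    have : 1 - a ≠ 0 := by linarith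
    exact_mod_cast this
  have haroot' : (a : ℂ) ^ 3 + (12 * t + 1) * (a : ℂ) ^ 2 + -((12 * t + 1) + 3) * a + 1 = 0 := by
    have h := congrArg (Complex.ofReal) haroot
    push_cast at h
    linear_combination h
  have hroot : (a : ℂ) ^ 3 + P.b * (a : ℂ) ^ 2 + P.c * a + P.d = 0 := by
    simp only [P]; push_cast; linear_combination haroot'
  obtain ⟨hb, hc, hd⟩ := simplest_vieta h0 h1 haroot'
  have hNF := Cubic.numberField_adjoin rfl hroot
  have h3 := Cubic.finrank_adjoin rfl hirr hroot
  have hgen := Cubic.gen_root hroot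
  have hdisc := discr_eq_of_simplest_cubic (fun p hp h5 => (ht p hp h5).2)
    (Cubic.isIntegral_of_root rfl hgen) h3 (Cubic.minpoly_eq_toPoly rfl hirr hgen)
  set K := IntermediateField.adjoin ℚ {(a : ℂ)}
  have haK : (a : ℂ) ∈ K := IntermediateField.mem_adjoin_simple_self ℚ _
  have hne : simplestCubic (12 * t + 1) ≠ 0 := by
    rw [simplestCubic_eq]; exact Cubic.ne_zero_of_a_ne_zero one_ne_zero
  have hsplit : K = IntermediateField.adjoin ℚ ((simplestCubic (12 * t + 1)).rootSet ℂ) := by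
    apply le_antisymm
    · refine IntermediateField.adjoin_simple_le_iff.mpr (IntermediateField.subset_adjoin _ _ ?_)
      rw [mem_rootSet]
      refine ⟨hne, ?_⟩
      simp only [simplestCubic_eq, Cubic.toPoly]
      simp
      linear_combination haroot'
    · rw [IntermediateField.adjoin_le_iff]
      intro w hw
      have hw' := (mem_rootSet.mp hw).2
      simp only [simplestCubic_eq, Cubic.toPoly] at hw'
      simp at hw'
      have hprod : (w - a) * (w - (1 - (a : ℂ))⁻¹) * (w - (1 - (a : ℂ)⁻¹)) = 0 := by
        linear_combination hw' - hb * w ^ 2 - hc * w - hd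
      rcases mul_eq_zero.mp hprod with h | h
      · rcases mul_eq_zero.mp h with h | h
        · rw [sub_eq_zero.mp h]; exact haK
        · rw [sub_eq_zero.mp h]; exact inv_mem (sub_mem (one_mem _) haK)
      · rw [sub_eq_zero.mp h]; exact sub_mem (one_mem _) (inv_mem haK)
  have hgal : IsGalois ℚ K := by
    have hsf := IntermediateField.adjoin_rootSet_isSplittingField
      (IsAlgClosed.splits ((simplestCubic (12 * t + 1)).map (algebraMap ℚ ℂ)))
    rw [← hsplit] at hsf
    have hnormal : Normal ℚ K :=
      Normal.of_isSplittingField (hFEp := hsf) (simplestCubic (12 * t + 1))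
    exact ⟨⟩
  have hcyc : IsCyclic (K ≃ₐ[ℚ] K) := by
    have := Fact.mk Nat.prime_three
    exact isCyclic_of_prime_card (p := 3) ((IsGalois.card_aut_eq_finrank ℚ K).trans h3)
  have habs : absDiscr K = (((12 * t + 1) ^ 2 + 3 * (12 * t + 1) + 9) ^ 2 : ℝ) := by
    rw [absDiscr, hdisc]
    push_cast
    exact abs_of_nonneg (by positivity)
  have ht0 : (0 : ℝ) ≤ t := Nat.cast_nonneg t
  have hM : max 1 ‖(a : ℂ)‖ * max 1 ‖(1 - (a : ℂ))⁻¹‖ * max 1 ‖1 - (a : ℂ)⁻¹‖ = a⁻¹ := by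
    have e1 : ‖(a : ℂ)‖ = a := by rw [Complex.norm_real, Real.norm_of_nonneg ha0.le]
    have e2 : ‖(1 - (a : ℂ))⁻¹‖ = (1 - a)⁻¹ := by
      rw [norm_inv, show (1 - (a : ℂ)) = ((1 - a : ℝ) : ℂ) by push_cast; rfl, Complex.norm_real,
        Real.norm_of_nonneg (by linarith)]
    have h2 : 2 < a⁻¹ := by
      rw [lt_inv_comm₀ two_pos ha0]; linarith
    have e3 : ‖1 - (a : ℂ)⁻¹‖ = a⁻¹ - 1 := by
      rw [show (1 - (a : ℂ)⁻¹) = ((1 - a⁻¹ : ℝ) : ℂ) by push_cast; rfl, Complex.norm_real,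
        Real.norm_eq_abs, abs_of_neg (by linarith)]
      ring
    have h4 : 1 ≤ (1 - a)⁻¹ := (one_le_inv₀ (by linarith)).mpr (by linarith)
    rw [e1, e2, e3, max_eq_left (by linarith), max_eq_right h4, max_eq_right (by linarith)]
    have : 1 - a ≠ 0 := by linarith
    field_simp
  obtain ⟨m, hm, hle⟩ := Cubic.exists_hasMinIntegralMahler_le rfl hirr hroot
    (x := a) (y := (1 - (a : ℂ))⁻¹) (z := 1 - (a : ℂ)⁻¹)
    (by simp only [P]; push_cast; exact hb) (by simp only [P]; push_cast; linear_combination hc)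
    (by simp only [P]; push_cast; exact hd)
    (by rw [hM]; exact (inv_eq_one.not.mpr (by linarith)))
  rw [hM] at hle
  refine ⟨K, hNF, ⟨⟨12 * t + 1, hsplit⟩, ⟨h3, hgal, hcyc⟩, m, hm, hle.trans_lt ?_⟩, ?_⟩
  · refine lt_mul_rpow_quarter (by positivity) (by rw [habs]; positivity) ?_
    rw [two_rpow_half_pow_four, habs]
    -- The equation reads `(n + 3) a = 1 + n a² + a³ > 1`.
    have hlt : a⁻¹ < 12 * t + 4 := by
      rw [inv_lt_iff_one_lt_mul₀ ha0]
      nlinarith [pow_pos ha0 3, pow_pos ha0 2]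
    calc a⁻¹ ^ 4 < (12 * t + 4 : ℝ) ^ 4 := by gcongr
      _ = ((12 * t + 4 : ℝ) ^ 2) ^ 2 := by ring
      _ ≤ (2 * ((12 * t + 1) ^ 2 + 3 * (12 * t + 1) + 9 : ℝ)) ^ 2 := by
        gcongr; nlinarith
      _ = _ := by ring
  · rw [habs]
    have hB : B ≤ t := (Nat.le_ceil B).trans (by exact_mod_cast htB)
    nlinarith [mul_nonneg ht0 ht0]

end Simplest

/-! ### The totally real non-Galois family -/

section RealFamily

lemma mem_rootSet_realCubic {n : ℕ} {α : ℂ} (h : α ^ 3 - n * α ^ 2 + n = 0) :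
    α ∈ (realCubic n).rootSet ℂ := by
  have hpoly : realCubic n = (⟨1, -n, 0, n⟩ : Cubic ℚ).toPoly := by
    simp only [realCubic, Cubic.toPoly, map_neg, map_one, map_zero]
    ring
  rw [mem_rootSet]
  refine ⟨hpoly ▸ Cubic.ne_zero_of_a_ne_zero one_ne_zero, ?_⟩
  simpa [realCubic] using h

/-- Otherwise `4n² - 27` would be a square, yet for `n > 7` it lies strictly between `(2n - 1)²` and
`(2n)²`. -/
lemma not_isSquare_real_discr {n : ℤ} (hn : 7 < n) :
    ¬ IsSquare ((n ^ 2 * ((2 * n) ^ 2 - 27) : ℤ) : ℚ) := by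
  rw [Rat.isSquare_intCast_iff]
  rintro ⟨r, hr⟩
  have hdvd : n ∣ r := by
    rw [← Int.pow_dvd_pow_iff two_ne_zero, sq r, ← hr]
    exact dvd_mul_right _ _
  obtain ⟨k, rfl⟩ := hdvd
  have hk : |k| ^ 2 = (2 * n) ^ 2 - 27 := by
    rw [sq_abs]
    have hn2 : n ^ 2 ≠ 0 := by positivity
    exact mul_left_cancel₀ hn2 (by linear_combination -hr)
  have h1 : |k| < 2 * n := lt_of_pow_lt_pow_left₀ 2 (by omega) (by omega)
  have h2 : 2 * n - 1 < |k| := lt_of_pow_lt_pow_left₀ 2 (abs_nonneg k) (by nlinarith)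
  omega

lemma unbounded_realCubic (B : ℝ) : ∃ (K : IntermediateField ℚ ℂ) (_ : NumberField K),
    ((∃ n : ℕ, IsRootField (realCubic n) K) ∧ IsTotallyRealNonGaloisCubic K ∧
      ∃ m, HasMinIntegralMahler K m ∧ m < absDiscr K ^ (1 / 4 : ℝ)) ∧
    B < absDiscr K := by
  -- The extra 1 forces `t ≥ 1`, hence `n ≥ 13`, which the root estimates and the non-square
  -- argument use.
  obtain ⟨t, htB, ht⟩ := exists_forall_prime_sq_not_dvd 2 (c := 27 * -1) (Or.inr rfl) (⌈B⌉₊ + 1)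
  have ht1 : (1 : ℝ) ≤ t := by exact_mod_cast (by omega : 1 ≤ t)
  set n : ℝ := 12 * t + 1 with hn
  have hn13 : 13 ≤ n := by linarith
  -- The values at `-1, 0, 1, 2, n` are `-1, n, 1, 8 - 3n, n`. Only the root in `(-1, 0)` lies
  -- inside the unit disc.
  obtain ⟨x, hx1, hx0, hx⟩ : ∃ x : ℝ, -1 < x ∧ x < 0 ∧ x ^ 3 + -n * x ^ 2 + 0 * x + n = 0 :=
    exists_cubic_root_of_neg_pos (by norm_num) (by norm_num) (by norm_num; linarith)
  obtain ⟨y, hy1, hy2, hy⟩ : ∃ y : ℝ, 1 < y ∧ y < 2 ∧ y ^ 3 + -n * y ^ 2 + 0 * y + n = 0 :=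
    exists_cubic_root_of_pos_neg (by norm_num) (by norm_num) (by norm_num; linarith)
  obtain ⟨z, hz2, -, hz⟩ : ∃ z : ℝ, 2 < z ∧ z < n ∧ z ^ 3 + -n * z ^ 2 + 0 * z + n = 0 :=
    exists_cubic_root_of_neg_pos (by linarith) (by norm_num; linarith) (by ring_nf; linarith)
  obtain ⟨hb, hc, hd⟩ := Cubic.vieta_of_three_roots hx hy hz (by linarith) (by linarith)
    (by linarith)
  have hbC := congrArg Complex.ofReal hb
  have hcC := congrArg Complex.ofReal hc
  have hdC := congrArg Complex.ofReal hd
  rw [hn] at hbC hdC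
  push_cast at hbC hcC hdC
  let P : Cubic ℤ := ⟨1, -1 * (12 * t + 1), 0, 12 * t + 1⟩
  have hodd : Odd (12 * (t : ℤ) + 1) := ⟨6 * t, by ring⟩
  have hirr : Irreducible P.toPoly := Cubic.irreducible_toPoly_of_odd rfl hodd
    (by simp only [P, add_zero]; exact Odd.mul (by decide) hodd)
  have hb' : (P.b : ℂ) = -(x + y + z) := by
    simp only [P]; push_cast; linear_combination hbC
  have hc' : (P.c : ℂ) = x * y + x * z + y * z := by
    simp only [P]; push_cast; linear_combination hcC
  have hd' : (P.d : ℂ) = -(x * y * z) := by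
    simp only [P]; push_cast; linear_combination hdC
  have hroot : (x : ℂ) ^ 3 + P.b * (x : ℂ) ^ 2 + P.c * x + P.d = 0 := by
    rw [hb', hc', hd']; ring
  have hNF := Cubic.numberField_adjoin rfl hroot
  have h3 := Cubic.finrank_adjoin rfl hirr hroot
  have hgen := Cubic.gen_root hroot
  have hint := Cubic.isIntegral_of_root rfl hgen
  have hmin := Cubic.minpoly_eq_toPoly rfl hirr hgen
  have hdisc := discr_eq_of_cubic_sq_add (Or.inr rfl) ht hint h3 hmin
  have htop := adjoin_eq_top_of_minpoly_cubic rfl hint hmin h3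
  set K := IntermediateField.adjoin ℚ {(x : ℂ)}
  have hreal : NumberField.IsTotallyReal K := by
    refine isTotallyReal_of_forall_embedding_conj htop fun f => ?_
    have hf := root_of_minpoly_cubic rfl hmin f
    rw [hb', hc', hd'] at hf
    generalize f (IntermediateField.AdjoinSimple.gen ℚ (x : ℂ)) = w at hf ⊢
    have hprod : (w - x) * (w - y) * (w - z) = 0 := by linear_combination hf
    rcases mul_eq_zero.mp hprod with h | h
    · rcases mul_eq_zero.mp h with h | h <;> rw [sub_eq_zero.mp h, Complex.conj_ofReal]
    · rw [sub_eq_zero.mp h, Complex.conj_ofReal]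
  have hngal : ¬ IsGalois ℚ K := fun hgal => by
    have hsq := isSquare_discr_of_isGalois rfl hint hmin h3 hgal
    have ht1' : 1 ≤ t := by omega
    refine not_isSquare_real_discr (n := 12 * t + 1) (by omega) ?_
    convert hsq using 2
    simp only [P, Cubic.discr]
    ring
  have habs : absDiscr K = n ^ 2 * ((2 * n) ^ 2 - 27) := by
    rw [absDiscr, hdisc, hn]
    push_cast
    rw [abs_of_nonneg]
    · ring
    · have : (0 : ℝ) ≤ (12 * t + 1) ^ 2 * ((24 * t + 2) ^ 2 - 27) :=
        mul_nonneg (by positivity) (by nlinarith)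
      linarith
  have hM : max 1 ‖(x : ℂ)‖ * max 1 ‖(y : ℂ)‖ * max 1 ‖(z : ℂ)‖ = y * z := by
    simp only [Complex.norm_real, Real.norm_eq_abs]
    rw [abs_of_neg hx0, abs_of_pos (by linarith : 0 < y), abs_of_pos (by linarith : 0 < z),
      max_eq_left (by linarith), max_eq_right hy1.le, max_eq_right (by linarith), one_mul]
  obtain ⟨m, hm, hle⟩ := Cubic.exists_hasMinIntegralMahler_le rfl hirr hroot hb' hc' hd'
    (by rw [hM]; nlinarith)
  rw [hM] at hle
  have hD : 0 ≤ absDiscr K := abs_nonneg _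
  refine ⟨K, hNF, ⟨⟨12 * t + 1, x, mem_rootSet_realCubic ?_, rfl⟩, ⟨h3, hreal, hngal⟩, m, hm,
    hle.trans_lt ?_⟩, ?_⟩
  · rw [← hroot]; simp only [P]; push_cast; ring
  · rw [← one_mul (absDiscr K ^ _)]
    refine lt_mul_rpow_quarter zero_le_one hD ?_
    have hyz : 0 < y * z := by nlinarith
    -- the product of the two large roots satisfies `(y z)² = n (n - x)`
    have hsq : (y * z) ^ 2 = n * (n - x) := by
      have hx2 : x ^ 2 ≠ 0 := pow_ne_zero 2 hx0.ne
      refine mul_left_cancel₀ hx2 ?_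
      linear_combination (-(x * y * z) + n) * -hd + n * hx
    have hlt : (y * z) ^ 2 < n * (n + 1) := by rw [hsq]; nlinarith
    calc (y * z) ^ 4 = ((y * z) ^ 2) ^ 2 := by ring
      _ < (n * (n + 1)) ^ 2 := by gcongr
      _ = n ^ 2 * (n + 1) ^ 2 := by ring
      _ ≤ n ^ 2 * ((2 * n) ^ 2 - 27) := by gcongr; nlinarith
      _ = _ := by rw [habs]; ring
  · rw [habs]
    have hB : B ≤ t := (Nat.le_ceil B).trans (by exact_mod_cast (by omega : ⌈B⌉₊ ≤ t))
    have h1 : n ≤ (2 * n) ^ 2 - 27 := by nlinarith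
    nlinarith

end RealFamily

/-! ### The family that is not totally real -/

section ComplexFamily

lemma mem_rootSet_complexCubic {n : ℕ} {α : ℂ} (h : α ^ 3 + n * α ^ 2 + n = 0) :
    α ∈ (complexCubic n).rootSet ℂ := by
  have hpoly : complexCubic n = (⟨1, n, 0, n⟩ : Cubic ℚ).toPoly := by
    simp only [complexCubic, Cubic.toPoly, map_one, map_zero]
    ring
  rw [mem_rootSet]
  refine ⟨hpoly ▸ Cubic.ne_zero_of_a_ne_zero one_ne_zero, ?_⟩
  simpa [complexCubic] using h

/-- The real root `-s` of `x³ + n x² + n` lies slightly to the left of `-n`. -/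
lemma exists_complexCubic_real_root {n : ℝ} (hn : 0 < n) :
    ∃ s : ℝ, n < s ∧ s < n + 1 / n ∧ s ^ 2 * (s - n) = n := by
  obtain ⟨x, h1, h2, hx⟩ := exists_cubic_root_of_neg_pos (b := n) (c := 0) (d := n)
    (u := -(n + 1 / n)) (v := -n) (by linarith [one_div_pos.mpr hn]) (by
      have h : (-(n + 1 / n)) ^ 3 + n * (-(n + 1 / n)) ^ 2 + 0 * (-(n + 1 / n)) + n =
        -(2 / n + 1 / n ^ 3) := by field_simp; ring
      rw [h]
      have : 0 < 2 / n + 1 / n ^ 3 := by positivity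
      linarith) (by ring_nf; linarith)
  exact ⟨-x, by linarith, by linarith, by linear_combination -hx⟩

/-- The complex pair has squared modulus `n / s < 1`, where `-s` is the real root, so the measure is
`s`, barely above `n`. The field is generated by a nonreal root, so that its inclusion in `ℂ` is a
nonreal embedding. -/
lemma unbounded_complexCubic (B : ℝ) : ∃ (K : IntermediateField ℚ ℂ) (_ : NumberField K),
    ((∃ n : ℕ, IsRootField (complexCubic n) K) ∧ IsNonTotallyRealCubic K ∧
      ∃ m, HasMinIntegralMahler K m ∧ m < 2 ^ (-(1 / 2) : ℝ) * absDiscr K ^ (1 / 4 : ℝ)) ∧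
    B < absDiscr K := by
  obtain ⟨t, htB, ht⟩ := exists_forall_prime_sq_not_dvd 2 (c := 27 * 1) (Or.inl rfl) (⌈B⌉₊ + 1)
  have ht1 : (1 : ℝ) ≤ t := by exact_mod_cast (by omega : 1 ≤ t)
  set n : ℝ := 12 * t + 1 with hn
  have hn13 : 13 ≤ n := by linarith
  have hn0 : 0 < n := by linarith
  obtain ⟨s, hs1, hs2, hs⟩ := exists_complexCubic_real_root hn0
  have hs0 : 0 < s := by linarith
  have hninv : 1 / n ≤ 1 / 13 := by gcongr
  set δ := s - n with hδ
  have hδ1 : δ < 1 := by linarith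
  have hδ0 : 0 < δ := by linarith
  -- the complex roots have real part `δ / 2` and product `s δ = n / s < 1`
  have hsδ : s * δ = n / s := by field_simp; linarith
  have hsδ1 : s * δ < 1 := by rw [hsδ, div_lt_one hs0]; exact hs1
  have hwpos : 0 < s * δ - δ ^ 2 / 4 := by nlinarith
  set w := √(s * δ - δ ^ 2 / 4)
  have hw0 : 0 < w := Real.sqrt_pos.mpr hwpos
  have hw2 : w ^ 2 = s * δ - δ ^ 2 / 4 := Real.sq_sqrt hwpos.le
  have hsC : (s : ℂ) ^ 2 * δ = 12 * t + 1 := by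
    have h := congrArg Complex.ofReal hs
    rw [hn] at h
    push_cast at h
    exact h
  have hδC : (δ : ℂ) = s - (12 * t + 1) := by
    rw [hδ, hn]; push_cast; ring
  let P : Cubic ℤ := ⟨1, 1 * (12 * t + 1), 0, 12 * t + 1⟩
  have hodd : Odd (12 * (t : ℤ) + 1) := ⟨6 * t, by ring⟩
  have hirr : Irreducible P.toPoly := Cubic.irreducible_toPoly_of_odd rfl hodd
    (by simp only [P, add_zero, one_mul]; exact hodd)
  set y : ℂ := ⟨δ / 2, w⟩ with hy
  set z : ℂ := ⟨δ / 2, -w⟩ with hz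
  have hyz : y + z = δ := by apply Complex.ext <;> simp [hy, hz]
  have hyz' : y * z = s * δ := by
    apply Complex.ext
    · simp [hy, hz]; linear_combination hw2
    · simp [hy, hz]; ring
  have hb' : (P.b : ℂ) = -(((-s : ℝ) : ℂ) + y + z) := by
    simp only [P]; push_cast; linear_combination hyz + hδC
  have hc' : (P.c : ℂ) = ((-s : ℝ) : ℂ) * y + ((-s : ℝ) : ℂ) * z + y * z := by
    simp only [P]; push_cast; linear_combination s * hyz - hyz'
  have hd' : (P.d : ℂ) = -(((-s : ℝ) : ℂ) * y * z) := by
    simp only [P]; push_cast; linear_combination -s * hyz' - hsC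
  have hroot : y ^ 3 + P.b * y ^ 2 + P.c * y + P.d = 0 := by
    rw [hb', hc', hd']; ring
  have hNF := Cubic.numberField_adjoin rfl hroot
  have h3 := Cubic.finrank_adjoin rfl hirr hroot
  have hgen := Cubic.gen_root hroot
  have hint := Cubic.isIntegral_of_root rfl hgen
  have hmin := Cubic.minpoly_eq_toPoly rfl hirr hgen
  have hdisc := discr_eq_of_cubic_sq_add (Or.inl rfl) ht hint h3 hmin
  set K := IntermediateField.adjoin ℚ {y}
  have hnreal : ¬ NumberField.IsTotallyReal K := by
    refine not_isTotallyReal_of_embedding (algebraMap K ℂ)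
      (α := IntermediateField.AdjoinSimple.gen ℚ y) ?_
    rw [IntermediateField.AdjoinSimple.algebraMap_gen]
    intro h
    have := Complex.conj_eq_iff_im.mp h
    exact hw0.ne' this
  have habs : absDiscr K = n ^ 2 * ((2 * n) ^ 2 + 27) := by
    rw [absDiscr, hdisc, hn]
    push_cast
    rw [abs_of_nonpos]
    · ring
    · have : (0 : ℝ) ≤ (12 * t + 1) ^ 2 * ((24 * t + 2) ^ 2 + 27) := by positivity
      linarith
  have hy1 : ‖y‖ ≤ 1 := by
    refine (sq_le_one_iff₀ (norm_nonneg y)).mp ?_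
    rw [← Complex.normSq_eq_norm_sq, hy, Complex.normSq_mk]
    nlinarith
  have hz1 : ‖z‖ ≤ 1 := by
    refine (sq_le_one_iff₀ (norm_nonneg z)).mp ?_
    rw [← Complex.normSq_eq_norm_sq, hz, Complex.normSq_mk]
    nlinarith
  have hM : max 1 ‖((-s : ℝ) : ℂ)‖ * max 1 ‖y‖ * max 1 ‖z‖ = s := by
    rw [max_eq_left hy1, max_eq_left hz1, Complex.norm_real, norm_neg, Real.norm_of_nonneg hs0.le,
      max_eq_right (by linarith), mul_one, mul_one]
  obtain ⟨m, hm, hle⟩ := Cubic.exists_hasMinIntegralMahler_le rfl hirr hroot hb' hc' hd'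
    (by rw [hM]; linarith)
  rw [hM] at hle
  have hD : 0 ≤ absDiscr K := abs_nonneg _
  refine ⟨K, hNF, ⟨⟨12 * t + 1, y, mem_rootSet_complexCubic ?_, rfl⟩, ⟨h3, hnreal⟩, m, hm,
    hle.trans_lt ?_⟩, ?_⟩
  · rw [← hroot]; simp only [P]; push_cast; ring
  · refine lt_mul_rpow_quarter (by positivity) hD ?_
    rw [two_rpow_neg_half_pow_four, habs]
    have h1 : s ^ 2 ≤ n ^ 2 + 3 := by
      have hn1 : n * (1 / n) = 1 := by field_simp
      calc s ^ 2 ≤ (n + 1 / n) ^ 2 := by gcongr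
        _ = n ^ 2 + 2 * (n * (1 / n)) + (1 / n) ^ 2 := by ring
        _ ≤ n ^ 2 + 3 := by
          have : (1 / n) ^ 2 ≤ 1 := pow_le_one₀ (by positivity) (by linarith)
          linarith
    -- The target is `|D| / 4 = n⁴ + (27/4) n²`, whose middle coefficient beats the 6 in `(n² + 3)²
    -- = n⁴ + 6n² + 9` once `n ≥ 13`.
    calc s ^ 4 = (s ^ 2) ^ 2 := by ring
      _ ≤ (n ^ 2 + 3) ^ 2 := by gcongr
      _ < _ := by nlinarith
  · rw [habs]
    have hB : B ≤ t := (Nat.le_ceil B).trans (by exact_mod_cast (by omega : ⌈B⌉₊ ≤ t))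
    nlinarith

end ComplexFamily

/-! ### Assembly -/

theorem theorem1 :
    -- infinitely many fields of each type with `M(𝓞 K) ≤ 2^(1/2) |D_K|^(1/4)`
    (InfinitelyManyFields (fun K _ => IsCyclicCubic K ∧
        ∃ m, HasMinIntegralMahler K m ∧ m ≤ 2 ^ (1 / 2 : ℝ) * absDiscr K ^ (1 / 4 : ℝ)) ∧
      InfinitelyManyFields (fun K _ => IsTotallyRealNonGaloisCubic K ∧
        ∃ m, HasMinIntegralMahler K m ∧ m ≤ 2 ^ (1 / 2 : ℝ) * absDiscr K ^ (1 / 4 : ℝ)) ∧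
      InfinitelyManyFields (fun K _ => IsNonTotallyRealCubic K ∧
        ∃ m, HasMinIntegralMahler K m ∧ m ≤ 2 ^ (1 / 2 : ℝ) * absDiscr K ^ (1 / 4 : ℝ))) ∧
    -- the exponent `1/4` cannot be increased in a lower bound, for any of the three types
    (ExponentQuarterIsSharp (fun K _ => IsCyclicCubic K) ∧
      ExponentQuarterIsSharp (fun K _ => IsTotallyRealNonGaloisCubic K) ∧
      ExponentQuarterIsSharp (fun K _ => IsNonTotallyRealCubic K)) ∧
    -- such fields occur in three explicit families, with the constants `2^(1/2)`, `1`, `2^(-1/2)`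
    (InfinitelyManyFields (fun K _ => (∃ n : ℕ, IsSplittingFieldIn (simplestCubic n) K) ∧
        IsCyclicCubic K ∧
        ∃ m, HasMinIntegralMahler K m ∧ m < 2 ^ (1 / 2 : ℝ) * absDiscr K ^ (1 / 4 : ℝ)) ∧
      InfinitelyManyFields (fun K _ => (∃ n : ℕ, IsRootField (realCubic n) K) ∧
        IsTotallyRealNonGaloisCubic K ∧
        ∃ m, HasMinIntegralMahler K m ∧ m < absDiscr K ^ (1 / 4 : ℝ)) ∧
      InfinitelyManyFields (fun K _ => (∃ n : ℕ, IsRootField (complexCubic n) K) ∧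
        IsNonTotallyRealCubic K ∧
        ∃ m, HasMinIntegralMahler K m ∧
          m < 2 ^ (-(1 / 2) : ℝ) * absDiscr K ^ (1 / 4 : ℝ))) := by
  have hcyc (B : ℝ) : ∃ (K : IntermediateField ℚ ℂ) (_ : NumberField K), (IsCyclicCubic K ∧
      ∃ m, HasMinIntegralMahler K m ∧ m ≤ 2 ^ (1 / 2 : ℝ) * absDiscr K ^ (1 / 4 : ℝ)) ∧
      B < absDiscr K := by
    obtain ⟨K, hK, ⟨-, hT, m, hm, hlt⟩, hB⟩ := unbounded_simplestCubic B
    exact ⟨K, hK, ⟨hT, m, hm, hlt.le⟩, hB⟩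
  have hreal (B : ℝ) : ∃ (K : IntermediateField ℚ ℂ) (_ : NumberField K),
      (IsTotallyRealNonGaloisCubic K ∧
      ∃ m, HasMinIntegralMahler K m ∧ m ≤ 2 ^ (1 / 2 : ℝ) * absDiscr K ^ (1 / 4 : ℝ)) ∧
      B < absDiscr K := by
    obtain ⟨K, hK, ⟨-, hT, m, hm, hlt⟩, hB⟩ := unbounded_realCubic B
    refine ⟨K, hK, ⟨hT, m, hm, hlt.le.trans ?_⟩, hB⟩
    exact le_mul_of_one_le_left (Real.rpow_nonneg (abs_nonneg _) _)
      (Real.one_le_rpow (by norm_num) (by norm_num))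
  have hcomplex (B : ℝ) : ∃ (K : IntermediateField ℚ ℂ) (_ : NumberField K),
      (IsNonTotallyRealCubic K ∧
      ∃ m, HasMinIntegralMahler K m ∧ m ≤ 2 ^ (1 / 2 : ℝ) * absDiscr K ^ (1 / 4 : ℝ)) ∧
      B < absDiscr K := by
    obtain ⟨K, hK, ⟨-, hT, m, hm, hlt⟩, hB⟩ := unbounded_complexCubic B
    refine ⟨K, hK, ⟨hT, m, hm, hlt.le.trans ?_⟩, hB⟩
    exact mul_le_mul_of_nonneg_right
      (Real.rpow_le_rpow_of_exponent_le (by norm_num) (by norm_num))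
      (Real.rpow_nonneg (abs_nonneg _) _)
  exact ⟨⟨infinitelyManyFields_of_unbounded hcyc, infinitelyManyFields_of_unbounded hreal,
      infinitelyManyFields_of_unbounded hcomplex⟩,
    ⟨exponentQuarterIsSharp_of_unbounded hcyc, exponentQuarterIsSharp_of_unbounded hreal,
      exponentQuarterIsSharp_of_unbounded hcomplex⟩,
    infinitelyManyFields_of_unbounded unbounded_simplestCubic,
    infinitelyManyFields_of_unbounded unbounded_realCubic,
    infinitelyManyFields_of_unbounded unbounded_complexCubic⟩
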